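/- Let $F$ be a non-negatively graded supermanifold (local coordinates carry a parity and a weight in $\mathbb Z_{\ge 0}$, which are not related to each other; there are finitely many of them, and functions are graded, i.e. polynomial in the coordinates of positive weight), fibred over the supermanifold $M=F_0$, so that $C^\infty(M)$ is the algebra of functions of weight $0$ on $F$. Let $\mathrm{Vect}(F)$ be the direct sum of the spaces $\mathrm{Vect}_n(F)$ of vector fields of weight $n$, with the Lie superbracket $[\,\cdot\,,\cdot\,]$, let $\mathrm{Vect}_{<0}(F)=\bigoplus_{n<0}\mathrm{Vect}_n(F)$, and let $P$ be the projector onto $\mathrm{Vect}_{<0}(F)$ that kills the fields of weight $\ge 0$. Let $Q\in\mathrm{Vect}(F)$ be odd, of weight $+1$, with $[Q,Q]=0$. For $u,v\in \mathrm{Vect}_{<0}(F)$ and $f\in C^\infty(M)$ put $$du=P[Q,u],\qquad \{u,v\}=P[[Q,u],v]\;(=[[Q,u],v]),\qquad a(u)f=[[Q,u],f]=[Q,u]f ,$$ and let $\delta f=[d,f]$ be the graded commutator of $d$ with the multiplication by $f$, $\delta f(w)=d(fw)-(-1)^{\tilde f}f\,dw$. A tilde denotes parity; in the formulas below the elements whose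 parity occurs are homogeneous with respect to parity. Then: 1. For every $u\in\mathrm{Vect}_{<0}(F)$, $a(u)$ is a vector field on $M$ of parity $\tilde u+1$, i.e. a graded derivation of the sheaf of functions on $M$. 2. $\{u,fv\}=a(u)f\cdot v+(-1)^{(\tilde u+1)\tilde f}f\{u,v\}$ for all $u,v\in\mathrm{Vect}_{<0}(F)$, $f\in C^\infty(M)$. 3. $\{fu,v\}=(-1)^{\tilde f}f\{u,v\}+(-1)^{(\tilde f+\tilde u)\tilde v}a(v)f\cdot u+\delta f([u,v])$ for all $u,v\in\mathrm{Vect}_{<0}(F)$, $f\in C^\infty(M)$. 4. $\delta f$ is an operator on $\mathrm{Vect}_{<0}(F)$ of parity $\tilde f+1$ and weight $+1$. It is zero on $\mathrm{Vect}_{-1}(F)$, and on $\bigoplus_{n<-1}\mathrm{Vect}_n(F)$ it is the multiplication by the function $Qf$. In particular $\delta f([u,v])=Qf\cdot[u,v]$ for all $u,v\in \mathrm{Vect}_{<0}(F)$. 5. In any local coordinates, where $x^a$ are the coordinates of weight $0$ and $y^i$ those of positive weight, the coefficient of $\partial/\partial x^a$ in $Q$ has the form $Q(x^a)=\sum_{\mathbf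 w(y^i)=1}y^iQ_i^a(x)$ with $Q_i^a$ functions of weight $0$, of parity $\tilde y^i+\tilde x^a+1$, and $$Qf=\sum_{\mathbf w(y^i)=1}\sum_a y^iQ_i^a(x)\frac{\partial f}{\partial x^a}\qquad\text{for } f\in C^\infty(M)$$ (left partial derivatives). -/

import Mathlib

open TopologicalSpace
open scoped ContDiff Manifold DirectSum

universe u v

noncomputable section

/-- The sign `(-1)^p` of a parity `p`. -/
def sgn (p : ZMod 2) : ℝ := if p = 0 then 1 else -1

theorem sgn_add (p q : ZMod 2) : sgn (p + q) = sgn p * sgn q := by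
  have h : ∀ p : ZMod 2, p = 0 ∨ p = 1 := by decide
  have h2 : (1 + 1 : ZMod 2) = 0 := by decide
  rcases h p with rfl | rfl <;> rcases h q with rfl | rfl <;> simp [sgn, h2]

theorem sgn_eq_or (p : ZMod 2) : sgn p = 1 ∨ sgn p = -1 := by
  unfold sgn
  split_ifs <;> simp

/-! ### Smooth functions on open subsets of `ℝⁿ` -/

/-- The algebra `C^∞(U)` for `U ⊆ ℝⁿ` open. -/
abbrev SmoothFn (n : ℕ) (U : Opens (EuclideanSpace ℝ (Fin n))) : Type :=
  C^∞⟮𝓘(ℝ, EuclideanSpace ℝ (Fin n)), U; ℝ⟯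

/-- The partial derivative `∂g/∂x^a` of `g ∈ C^∞(U)`. -/
def SmoothFn.partialDeriv {n : ℕ} {U : Opens (EuclideanSpace ℝ (Fin n))} (a : Fin n)
    (g : SmoothFn n U) : SmoothFn n U where
  val := fun x => fderiv ℝ (Function.extend Subtype.val g (0 : EuclideanSpace ℝ (Fin n) → ℝ))
    (x : EuclideanSpace ℝ (Fin n)) (EuclideanSpace.single a 1)
  property := by
    intro x
    rw [contMDiffAt_subtype_iff
      (f := fun y => fderiv ℝ (Function.extend Subtype.val g (0 : EuclideanSpace ℝ (Fin n) → ℝ))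
        y (EuclideanSpace.single a 1))]
    have h : ContMDiffAt 𝓘(ℝ, EuclideanSpace ℝ (Fin n)) 𝓘(ℝ, ℝ) ∞
        (Function.extend Subtype.val g (0 : EuclideanSpace ℝ (Fin n) → ℝ))
        (x : EuclideanSpace ℝ (Fin n)) := by
      rw [← contMDiffAt_subtype_iff (U := U)]
      have : (fun y : U => Function.extend Subtype.val g
          (0 : EuclideanSpace ℝ (Fin n) → ℝ) (y : EuclideanSpace ℝ (Fin n))) = g := by
        funext y
        exact Subtype.val_injective.extend_apply _ _ _
      rw [this]
      exact g.contMDiff x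
    rw [contMDiffAt_iff_contDiffAt] at h ⊢
    exact (h.fderiv_right (m := ∞) le_rfl).clm_apply contDiffAt_const

/-! ### Graded dimension -/

/-- The graded dimension of a non-negatively graded supermanifold: `baseDim` even coordinates of
weight `0`, and `fibDim` further coordinates, with prescribed parities and weights. The further
coordinates are the odd ones of weight `0` and all those of positive weight; parity and weight are
not related to one another. -/
structure GradedDim where
  baseDim : ℕ
  fibDim : ℕ
  par : Fin fibDim → ZMod 2
  wt : Fin fibDim → ℕ
  wt_ne_zero : ∀ i, par i = 0 → wt i ≠ 0

namespace GradedDim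

variable (D : GradedDim)

/-- Labels of all the local coordinates. -/
abbrev Coord : Type := Fin D.baseDim ⊕ Fin D.fibDim

/-- Parity of a coordinate. -/
def coordPar : D.Coord → ZMod 2 := Sum.elim (fun _ => 0) D.par

/-- Weight of a coordinate. -/
def coordWt : D.Coord → ℕ := Sum.elim (fun _ => 0) D.wt

/-- Exponents of the monomials in the `fibDim` further coordinates (odd ones occur at most
once). -/
def Mono : Type := {μ : Fin D.fibDim → ℕ // ∀ i, D.par i = 1 → μ i ≤ 1}

end GradedDim

/-! ### Sheaves of graded functions -/

/-- A sheaf on `X` of supercommutative `ℤ`-graded algebras. `homog U (p, n)` consists of the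
functions over `U` of parity `p` and weight `n`; `fn U` is the direct sum of these, so gluing is
required in each degree. -/
structure GradedSheaf (X : Type u) [TopologicalSpace X] where
  fn : Opens X → Type v
  [ring : ∀ U, Ring (fn U)]
  [algebra : ∀ U, Algebra ℝ (fn U)]
  homog : ∀ U, ZMod 2 × ℤ → Submodule ℝ (fn U)
  [graded : ∀ U, GradedAlgebra (homog U)]
  supercomm : ∀ U (d e : ZMod 2 × ℤ) (f g : fn U), f ∈ homog U d → g ∈ homog U e →
    f * g = sgn (d.1 * e.1) • (g * f)
  res : ∀ {U V : Opens X}, V ≤ U → fn U →ₐ[ℝ] fn V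
  res_homog : ∀ {U V : Opens X} (h : V ≤ U) (d : ZMod 2 × ℤ) (f : fn U),
    f ∈ homog U d → res h f ∈ homog V d
  res_refl : ∀ (U : Opens X) (f : fn U), res (le_refl U) f = f
  res_res : ∀ {U V W : Opens X} (h : V ≤ U) (k : W ≤ V) (f : fn U),
    res k (res h f) = res (k.trans h) f
  glue : ∀ (d : ZMod 2 × ℤ) {J : Type u} (U : J → Opens X) (s : ∀ j, fn (U j)),
    (∀ j, s j ∈ homog (U j) d) →
    (∀ i j, res (inf_le_left : U i ⊓ U j ≤ U i) (s i) =
      res (inf_le_right : U i ⊓ U j ≤ U j) (s j)) →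
    ∃! t : fn (⨆ j, U j), t ∈ homog (⨆ j, U j) d ∧ ∀ j, res (le_iSup U j) t = s j

attribute [instance] GradedSheaf.ring GradedSheaf.algebra GradedSheaf.graded

namespace GradedSheaf

variable {X : Type u} [TopologicalSpace X] (F : GradedSheaf.{u, v} X)

/-! ### Local coordinates -/

/-- The open subset of `X` that corresponds to an open subset of the coordinate space. -/
def pre {n : ℕ} (φ : OpenPartialHomeomorph X (EuclideanSpace ℝ (Fin n)))
    (U : Opens (EuclideanSpace ℝ (Fin n))) : Opens X :=
  ⟨φ.source ∩ φ ⁻¹' U, φ.isOpen_inter_preimage U.2⟩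

theorem pre_mono {n : ℕ} (φ : OpenPartialHomeomorph X (EuclideanSpace ℝ (Fin n)))
    {U V : Opens (EuclideanSpace ℝ (Fin n))} (h : V ≤ U) : pre φ V ≤ pre φ U :=
  fun _ hx => ⟨hx.1, h hx.2⟩

/-- The ordered monomial `y_1 ^ μ_1 * y_2 ^ μ_2 * ⋯`. -/
def mon {k : ℕ} {U : Opens X} (y : Fin k → F.fn U) (μ : Fin k → ℕ) : F.fn U :=
  (List.ofFn fun i => y i ^ μ i).prod

/-- A system of local coordinates of graded dimension `D`. The even coordinates of weight `0` give
a homeomorphism `φ` of the domain onto an open subset of `ℝⁿ` and embeddings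
`g ↦ g(x)` of the smooth functions of `x` into the functions of degree `(0, 0)`; over every smaller
open set, each function is in a unique way a polynomial `∑ g_μ(x) y^μ` in the further
coordinates. -/
structure Chart (D : GradedDim) where
  φ : OpenPartialHomeomorph X (EuclideanSpace ℝ (Fin D.baseDim))
  y : Fin D.fibDim → F.fn (pre φ ⟨φ.target, φ.open_target⟩)
  y_homog : ∀ i, y i ∈ F.homog _ (D.par i, (D.wt i : ℤ))
  σ : ∀ U : Opens (EuclideanSpace ℝ (Fin D.baseDim)), U ≤ ⟨φ.target, φ.open_target⟩ →
    SmoothFn D.baseDim U →ₐ[ℝ] F.fn (pre φ U)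
  σ_homog : ∀ U hU g, σ U hU g ∈ F.homog _ (0, 0)
  σ_res : ∀ (U V : Opens (EuclideanSpace ℝ (Fin D.baseDim)))
    (hU : U ≤ ⟨φ.target, φ.open_target⟩) (h : V ≤ U) (g : SmoothFn D.baseDim U),
    F.res (pre_mono φ h) (σ U hU g) =
      σ V (h.trans hU) (ContMDiffMap.restrictRingHom 𝓘(ℝ, EuclideanSpace ℝ (Fin D.baseDim))
        𝓘(ℝ, ℝ) ℝ h g)
  bijective : ∀ U (hU : U ≤ ⟨φ.target, φ.open_target⟩),
    Function.Bijective fun s : D.Mono →₀ SmoothFn D.baseDim U =>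
      s.sum fun μ g => σ U hU g * F.mon (fun i => F.res (pre_mono φ hU) (y i)) μ.1

namespace Chart

variable {F} {D : GradedDim} (c : F.Chart D)

/-- The range of the even coordinates of weight `0`. -/
abbrev target : Opens (EuclideanSpace ℝ (Fin D.baseDim)) := ⟨c.φ.target, c.φ.open_target⟩

/-- The domain of the coordinate system. -/
abbrev dom : Opens X := pre c.φ c.target

/-- The smooth function `g(x)`, as an element of `F.fn c.dom`. -/
def ofSmooth (g : SmoothFn D.baseDim c.target) : F.fn c.dom := c.σ c.target le_rfl g

/-- The coordinate functions. -/
def coord : D.Coord → F.fn c.dom :=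
  Sum.elim
    (fun a => c.ofSmooth ⟨fun x => (x : EuclideanSpace ℝ (Fin D.baseDim)) a,
      ((EuclideanSpace.proj (𝕜 := ℝ) a).contMDiff).comp contMDiff_subtype_val⟩)
    c.y

/-- The coefficients `g_μ` in `f = ∑ g_μ(x) y^μ`. -/
def coeff (f : F.fn c.dom) : D.Mono →₀ SmoothFn D.baseDim c.target :=
  (Equiv.ofBijective _ (c.bijective c.target le_rfl)).symm f

/-- The (left) partial derivatives `∂f/∂z` of `f = ∑ g_μ(x) y^μ`: those with respect to `x` act on
the coefficients; the one with respect to `y_i` sends `y^μ` to `± μ_i y^(μ - e_i)`, where the sign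
comes from moving `∂/∂y_i` past the factors `y_j ^ μ_j` with `j < i`. -/
def pderiv : D.Coord → F.fn c.dom → F.fn c.dom :=
  Sum.elim
    (fun a f => (c.coeff f).sum fun μ g => c.ofSmooth (g.partialDeriv a) * F.mon (U := c.dom) c.y μ.1)
    (fun i f => (c.coeff f).sum fun μ g =>
      (sgn (D.par i * ∑ j with j < i, (μ.1 j : ZMod 2) * D.par j) * (μ.1 i : ℝ)) •
        (c.ofSmooth g * F.mon (U := c.dom) c.y (Function.update μ.1 i (μ.1 i - 1))))

end Chart

/-! ### Vector fields -/

/-- Vector fields of parity `d.1` and weight `d.2`: graded derivations, of this degree, of the sheaf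
of functions. -/
def VectHom (d : ZMod 2 × ℤ) : Submodule ℝ (∀ U : Opens X, F.fn U →ₗ[ℝ] F.fn U) where
  carrier := {A |
    (∀ (U V : Opens X) (h : V ≤ U) (f : F.fn U), F.res h (A U f) = A V (F.res h f)) ∧
    (∀ (U : Opens X) (e : ZMod 2 × ℤ) (f : F.fn U), f ∈ F.homog U e →
      A U f ∈ F.homog U (d + e)) ∧
    (∀ (U : Opens X) (e : ZMod 2 × ℤ) (f g : F.fn U), f ∈ F.homog U e →
      A U (f * g) = A U f * g + sgn (d.1 * e.1) • (f * A U g))}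
  zero_mem' := by
    refine ⟨fun U V h f => ?_, fun U e f _ => ?_, fun U e f g _ => ?_⟩ <;> simp
  add_mem' := by
    rintro A B ⟨hA1, hA2, hA3⟩ ⟨hB1, hB2, hB3⟩
    refine ⟨fun U V h f => ?_, fun U e f hf => ?_, fun U e f g hf => ?_⟩
    · simp [hA1, hB1]
    · exact Submodule.add_mem _ (hA2 U e f hf) (hB2 U e f hf)
    · simp only [Pi.add_apply, LinearMap.add_apply, hA3 U e f g hf, hB3 U e f g hf, add_mul,
        mul_add, smul_add]
      abel
  smul_mem' := by
    rintro r A ⟨hA1, hA2, hA3⟩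
    refine ⟨fun U V h f => ?_, fun U e f hf => ?_, fun U e f g hf => ?_⟩
    · simp [hA1]
    · exact Submodule.smul_mem _ r (hA2 U e f hf)
    · simp only [Pi.smul_apply, LinearMap.smul_apply, hA3 U e f g hf, smul_add, smul_mul_assoc,
        mul_smul_comm, smul_comm r]

/-- `Vect(F)`: the direct sum of the spaces of homogeneous vector fields. -/
abbrev Vect : Type (max u v) := ⨁ d : ZMod 2 × ℤ, F.VectHom d

instance : AddCommGroup F.Vect :=
  @DirectSum.instAddCommGroup _ (fun d => F.VectHom d) fun _ => inferInstance

/-- The action of vector fields on functions over `U`. -/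
def act (U : Opens X) : F.Vect →ₗ[ℝ] F.fn U →ₗ[ℝ] F.fn U :=
  DirectSum.toModule ℝ _ _ fun d => LinearMap.proj U ∘ₗ (F.VectHom d).subtype

theorem bracket_mem {d e : ZMod 2 × ℤ} {A B : ∀ U : Opens X, F.fn U →ₗ[ℝ] F.fn U}
    (hA : A ∈ F.VectHom d) (hB : B ∈ F.VectHom e) :
    (fun U => A U ∘ₗ B U - sgn (d.1 * e.1) • (B U ∘ₗ A U)) ∈ F.VectHom (d + e) := by
  obtain ⟨hA1, hA2, hA3⟩ := hA
  obtain ⟨hB1, hB2, hB3⟩ := hB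
  refine ⟨fun U V h f => ?_, fun U k f hf => ?_, fun U k f g hf => ?_⟩
  · simp [hA1, hB1]
  · refine Submodule.sub_mem _ ?_ (Submodule.smul_mem _ _ ?_)
    · simpa [add_assoc] using hA2 U _ _ (hB2 U k f hf)
    · have := hB2 U _ _ (hA2 U k f hf)
      rwa [← add_assoc, add_comm e d] at this
  · have h1 := hB2 U k f hf
    have h2 := hA2 U k f hf
    simp only [LinearMap.sub_apply, LinearMap.smul_apply, LinearMap.comp_apply, hA3 U k f g hf,
      hB3 U k f g hf, map_add, map_smul, hA3 U _ _ g h1, hB3 U _ _ g h2, hA3 U k f _ hf,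
      hB3 U k f _ hf, Prod.fst_add, mul_add, add_mul, sgn_add, mul_comm e.1 d.1, sub_mul, mul_sub,
      smul_add, smul_sub, smul_mul_assoc, mul_smul_comm, smul_smul]
    rcases sgn_eq_or (d.1 * e.1) with h | h <;> rw [h] <;> module

/-- The graded commutator `A B - (-1)^(d.1 * e.1) B A` of homogeneous vector fields. -/
def bracketHom (d e : ZMod 2 × ℤ) : F.VectHom d →ₗ[ℝ] F.VectHom e →ₗ[ℝ] F.VectHom (d + e) :=
  LinearMap.mk₂ ℝ (fun A B => ⟨_, F.bracket_mem A.2 B.2⟩)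
    (fun A A' B => by
      ext U f
      simp [smul_add]
      abel)
    (fun r A B => by
      ext U f
      simp [smul_sub, smul_comm r])
    (fun A B B' => by
      ext U f
      simp [smul_add]
      abel)
    (fun r A B => by
      ext U f
      simp [smul_sub, smul_comm r])

/-- The Lie superbracket `[A, B]` on `Vect(F)`. -/
def bracket : F.Vect →ₗ[ℝ] F.Vect →ₗ[ℝ] F.Vect :=
  DirectSum.toModule ℝ _ _ fun d => LinearMap.flip <|
    DirectSum.toModule ℝ _ _ fun e => LinearMap.flip <|
      (F.bracketHom d e).compr₂ (DirectSum.lof ℝ _ (fun d => F.VectHom d) (d + e))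

theorem smul_mem {e d : ZMod 2 × ℤ} {f : F.fn ⊤} (hf : f ∈ F.homog ⊤ e)
    {A : ∀ U : Opens X, F.fn U →ₗ[ℝ] F.fn U} (hA : A ∈ F.VectHom d) :
    (fun U => LinearMap.mulLeft ℝ (F.res (le_top : U ≤ ⊤) f) ∘ₗ A U) ∈ F.VectHom (e + d) := by
  obtain ⟨hA1, hA2, hA3⟩ := hA
  refine ⟨fun U V h g => ?_, fun U k g hg => ?_, fun U k g g' hg => ?_⟩
  · simp [hA1, F.res_res]
  · rw [add_assoc]
    exact SetLike.mul_mem_graded (F.res_homog _ _ _ hf) (hA2 U k g hg)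
  · have h1 := F.supercomm U e k (F.res le_top f) g (F.res_homog _ _ _ hf) hg
    simp only [LinearMap.comp_apply, LinearMap.mulLeft_apply, hA3 U k g g' hg, mul_add,
      mul_smul_comm, ← mul_assoc, h1, smul_mul_assoc, smul_smul, Prod.fst_add, add_mul, sgn_add]
    rw [mul_comm (sgn (d.1 * k.1))]

/-- The product `f A` of a homogeneous function and a homogeneous vector field. -/
def smulHom (e d : ZMod 2 × ℤ) : F.homog ⊤ e →ₗ[ℝ] F.VectHom d →ₗ[ℝ] F.VectHom (e + d) :=
  LinearMap.mk₂ ℝ (fun f A => ⟨_, F.smul_mem f.2 A.2⟩)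
    (fun f f' A => by
      ext U g
      simp [add_mul])
    (fun r f A => by
      ext U g
      simp)
    (fun f A A' => by
      ext U g
      simp [mul_add])
    (fun r f A => by
      ext U g
      simp)

/-- The product `f A` of a function on `F` and a vector field. -/
def smul : F.fn ⊤ →ₗ[ℝ] F.Vect →ₗ[ℝ] F.Vect :=
  (DirectSum.toModule ℝ _ _ fun e => LinearMap.flip <|
    DirectSum.toModule ℝ _ _ fun d => LinearMap.flip <|
      (F.smulHom e d).compr₂ (DirectSum.lof ℝ _ (fun d => F.VectHom d) (e + d))) ∘ₗ
    (DirectSum.decomposeLinearEquiv (F.homog ⊤)).toLinearMap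

/-- Vector fields of weight less than `k` (finite sums of homogeneous ones). -/
def below (k : ℤ) : Submodule ℝ F.Vect where
  carrier := {A | ∀ d : ZMod 2 × ℤ, k ≤ d.2 → A d = 0}
  zero_mem' := fun _ _ => rfl
  add_mem' := fun hA hB d hd => by simp [hA d hd, hB d hd]
  smul_mem' := fun r A hA d hd => by rw [DirectSum.smul_apply, hA d hd, smul_zero]

/-- `Vect_{<0}(F)`. -/
abbrev neg : Submodule ℝ F.Vect := F.below 0

/-- `Vect_n(F)`: vector fields of weight `n`. -/
def ofWeight (n : ℤ) : Submodule ℝ F.Vect where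
  carrier := {A | ∀ d : ZMod 2 × ℤ, d.2 ≠ n → A d = 0}
  zero_mem' := fun _ _ => rfl
  add_mem' := fun hA hB d hd => by simp [hA d hd, hB d hd]
  smul_mem' := fun r A hA d hd => by rw [DirectSum.smul_apply, hA d hd, smul_zero]

/-- Vector fields of parity `p`. -/
def ofParity (p : ZMod 2) : Submodule ℝ F.Vect where
  carrier := {A | ∀ d : ZMod 2 × ℤ, d.1 ≠ p → A d = 0}
  zero_mem' := fun _ _ => rfl
  add_mem' := fun hA hB d hd => by simp [hA d hd, hB d hd]
  smul_mem' := fun r A hA d hd => by rw [DirectSum.smul_apply, hA d hd, smul_zero]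

/-- The projector `P` of `Vect(F)` onto `Vect_{<0}(F)` that kills the fields of weight `≥ 0`. -/
def projNeg : F.Vect →ₗ[ℝ] F.Vect :=
  DFinsupp.filterLinearMap ℝ (fun d => F.VectHom d) fun d : ZMod 2 × ℤ => d.2 < 0

/-! ### The operations defined by a homological vector field -/

/-- `Q` is an odd vector field of weight `+1` with `[Q, Q] = 0`. -/
structure IsHomological (Q : F.Vect) : Prop where
  odd : Q ∈ F.ofParity 1
  weight : Q ∈ F.ofWeight 1
  bracket_self : F.bracket Q Q = 0

/-- `d u = P [Q, u]`. -/
def diff (Q : F.Vect) : F.Vect →ₗ[ℝ] F.Vect := F.projNeg ∘ₗ F.bracket Q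

/-- `{u, v} = P [[Q, u], v]`. -/
def newBracket (Q u v : F.Vect) : F.Vect := F.projNeg (F.bracket (F.bracket Q u) v)

/-- The anchor, `a(u) f = [[Q, u], f]` for functions `f` on `M`, that is, for functions of weight
`0` on `F` (over `U`); the bracket of a vector field and a function is the action. -/
def anchor (Q u : F.Vect) (U : Opens X) (f : F.fn U) : F.fn U := F.act U (F.bracket Q u) f

/-- `δf = [d, f]`, the graded commutator of the odd operator `d` and of the multiplication by a
function `f` of parity `p`: `w ↦ d (f w) - (-1)^p f (d w)`. -/
def delta (Q : F.Vect) (p : ZMod 2) (f : F.fn ⊤) : F.Vect →ₗ[ℝ] F.Vect :=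
  F.diff Q ∘ₗ F.smul f - sgn p • (F.smul f ∘ₗ F.diff Q)

end GradedSheaf

/-- A non-negatively graded supermanifold `F` of graded dimension `D`, described by the sheaf of its
graded functions on the topological space `X` that underlies the base: locally it has coordinates.
The functions on the base supermanifold `M = F₀` (pulled back to `F` along `F → M`) are the functions
of weight `0`. -/
structure GradedManifold (X : Type u) [TopologicalSpace X] [T2Space X]
    [SecondCountableTopology X] (D : GradedDim) extends GradedSheaf.{u, v} X where
  exists_chart : ∀ x : X, ∃ c : toGradedSheaf.Chart D, x ∈ c.dom

end

/-! Everything rests on the rules `[A, fB] = (Af)B ± f[A, B]` and `[fA, B] = f[A, B] ± (Bf)A`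
(`bracket_smul`, `smul_bracket`) and on weights: there are no functions of negative weight, so
fields of negative weight annihilate functions of weight 0 (`act_neg_eq_zero`).

For `u` of negative weight, `[Q, u]` has weights at most 0. Its part of weight 0 preserves the
functions on `M` and the rest kills them, so `a(u)` is a field on `M`. Likewise `[[Q, u], v]` has
negative weight, `P` does nothing in `{u, v}`, and the rule in the second argument is `bracket_smul`
for `[Q, u]`. In the first argument, `[Q, fu] = Qf·u ± f[Q, u]` is bracketed with `v`. Since `vf =
0`, the anchor `a(v)f` is `v(Qf)` up to sign, and the extra term is `Qf·[u, v]`. This equals `δf([u,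
v])` because `[u, v]` has weights at most -2, where `P` does not interfere (`delta_below`).

In a chart a derivation is `∑ A(z) ∂/∂z` (`Chart.map_eq_sum_pderiv`): Hadamard's lemma near each
point handles the smooth coefficients, the signed Leibniz rule the monomials. As `Q(x^a)` has weight
1, it is linear in the coordinates of weight 1, and a function of weight 0 has no derivatives along
coordinates of positive weight. -/

namespace GradedSheaf

/-! ### Homogeneous components of vector fields and their action on functions. -/

variable {X : Type u} [TopologicalSpace X] (F : GradedSheaf.{u, v} X)

/-- Vector fields all of whose homogeneous components have their degrees in `s`. -/
def degreesIn (s : Set (ZMod 2 × ℤ)) : Submodule ℝ F.Vect where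
  carrier := {A | ∀ d : ZMod 2 × ℤ, d ∉ s → A d = 0}
  zero_mem' := fun _ _ => rfl
  add_mem' := fun hA hB d hd => by simp [hA d hd, hB d hd]
  smul_mem' := fun r A hA d hd => by rw [DirectSum.smul_apply, hA d hd, smul_zero]

/-- A homogeneous vector field, as an element of `Vect(F)`. -/
abbrev single (d : ZMod 2 × ℤ) : F.VectHom d →ₗ[ℝ] F.Vect :=
  DirectSum.lof ℝ _ (fun d => F.VectHom d) d

variable {F}

theorem mem_ofParity_iff {p : ZMod 2} {A : F.Vect} :
    A ∈ F.ofParity p ↔ A ∈ F.degreesIn {d | d.1 = p} := Iff.rfl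

theorem mem_ofWeight_iff {n : ℤ} {A : F.Vect} :
    A ∈ F.ofWeight n ↔ A ∈ F.degreesIn {d | d.2 = n} := Iff.rfl

theorem mem_below_iff {k : ℤ} {A : F.Vect} :
    A ∈ F.below k ↔ A ∈ F.degreesIn {d | d.2 < k} := by
  simp [below, degreesIn]

theorem degreesIn_inf {s t : Set (ZMod 2 × ℤ)} {A : F.Vect} (hs : A ∈ F.degreesIn s)
    (ht : A ∈ F.degreesIn t) : A ∈ F.degreesIn (s ∩ t) := by
  intro d hd
  by_cases h : d ∈ s
  · exact ht d fun h' => hd ⟨h, h'⟩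
  · exact hs d h

theorem single_mem_degreesIn {s : Set (ZMod 2 × ℤ)} {d : ZMod 2 × ℤ} (hd : d ∈ s)
    (A : F.VectHom d) : F.single d A ∈ F.degreesIn s := by
  intro e he
  exact DirectSum.of_eq_of_ne (β := fun d => F.VectHom d) d e A (by rintro rfl; exact he hd)

/-- Induction over the homogeneous components. -/
@[elab_as_elim]
theorem degreesIn_induction {s : Set (ZMod 2 × ℤ)} {motive : F.Vect → Prop}
    (zero : motive 0) (add : ∀ A B, motive A → motive B → motive (A + B))
    (single : ∀ d ∈ s, ∀ A : F.VectHom d, motive (F.single d A))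
    (A : F.Vect) (hA : A ∈ F.degreesIn s) : motive A := by
  classical
  rw [← DirectSum.sum_support_of A]
  refine Finset.sum_induction _ motive add zero fun d hd => single d ?_ _
  by_contra h
  exact (DFinsupp.mem_support_iff.1 hd) (hA d h)

theorem mem_degreesIn_univ (A : F.Vect) : A ∈ F.degreesIn Set.univ :=
  fun d hd => (hd (Set.mem_univ d)).elim

@[simp]
theorem act_single (U : Opens X) (d : ZMod 2 × ℤ) (A : F.VectHom d) (f : F.fn U) :
    F.act U (F.single d A) f = A.1 U f := by
  simp [act, single, DirectSum.toModule_lof]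

theorem act_res {U V : Opens X} (h : V ≤ U) (A : F.Vect) (f : F.fn U) :
    F.res h (F.act U A f) = F.act V A (F.res h f) := by
  refine degreesIn_induction (s := Set.univ) ?_ ?_ ?_ A (mem_degreesIn_univ A)
  · simp
  · intro A B hA hB
    simp [hA, hB]
  · intro d _ A
    simp [A.2.1 U V h f]

theorem act_mul {p : ZMod 2} {A : F.Vect} (hA : A ∈ F.ofParity p) {U : Opens X}
    {e : ZMod 2 × ℤ} {f : F.fn U} (hf : f ∈ F.homog U e) (g : F.fn U) :
    F.act U A (f * g) = F.act U A f * g + sgn (p * e.1) • (f * F.act U A g) := by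
  refine degreesIn_induction ?_ ?_ ?_ A (mem_ofParity_iff.1 hA)
  · simp
  · intro A B hA hB
    simp only [map_add, LinearMap.add_apply, hA, hB, add_mul, mul_add, smul_add]
    abel
  · rintro d rfl A
    simp [A.2.2.2 U e f g hf]

/-- The second alternative serves fields with components of many weights: a component leading into a
zero space of functions contributes nothing, so the sum still lands in the one degree `e'`. -/
theorem act_mem {s : Set (ZMod 2 × ℤ)} {A : F.Vect} (hA : A ∈ F.degreesIn s) {U : Opens X}
    {e e' : ZMod 2 × ℤ} (h : ∀ d ∈ s, d + e = e' ∨ F.homog U (d + e) = ⊥)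
    {f : F.fn U} (hf : f ∈ F.homog U e) :
    F.act U A f ∈ F.homog U e' := by
  refine degreesIn_induction ?_ ?_ ?_ A hA
  · simp
  · intro A B hA hB
    rw [map_add]
    exact add_mem hA hB
  · intro d hd A
    rw [act_single]
    have := A.2.2.1 U e f hf
    rcases h d hd with rfl | h
    · exact this
    · rw [h, Submodule.mem_bot] at this
      rw [this]
      exact zero_mem _

/-- A vector field is determined by its action on functions. -/
theorem act_injective {A B : F.Vect} (h : ∀ U f, F.act U A f = F.act U B f) : A = B := by
  suffices H : ∀ A : F.Vect, (∀ U f, F.act U A f = 0) → A = 0 by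
    rw [← sub_eq_zero]
    exact H _ fun U f => by simp [h]
  clear h A B
  intro A h
  refine DFinsupp.ext fun d => Subtype.ext (funext fun U => LinearMap.ext fun f => ?_)
  change (A d).1 U f = 0
  -- Components of different degrees shift the degree of a homogeneous `f` differently, so the part
  -- of `A f` in degree `d + e` comes from `A d` alone.
  have key : ∀ e, ∀ f ∈ F.homog U e, ∀ A : F.Vect,
      (A d).1 U f = DirectSum.decompose (F.homog U) (F.act U A f) (d + e) := by
    intro e f hf A
    refine degreesIn_induction (s := Set.univ) ?_ ?_ ?_ A (mem_degreesIn_univ A)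
    · simp
    · intro A B hA hB
      simp [hA, hB]
    · intro d' _ A
      rw [act_single]
      have hm := A.2.2.1 U e f hf
      by_cases hd : d' = d
      · subst hd
        rw [DirectSum.decompose_of_mem_same _ hm]
        exact congrArg (fun B : F.VectHom d' => B.1 U f)
          (DirectSum.lof_apply (M := fun d => F.VectHom d) ℝ d' A)
      · rw [DirectSum.decompose_of_mem_ne _ hm (by simpa using hd)]
        have : F.single d' A d = 0 :=
          DirectSum.of_eq_of_ne (β := fun d => F.VectHom d) d' d A (Ne.symm hd)
        rw [this]
        rfl
  refine DirectSum.Decomposition.inductionOn (F.homog U) (by simp) (fun {e} f => ?_)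
    (fun f g hf hg => by rw [map_add, hf, hg, add_zero]) f
  rw [key e f f.2 A, h]
  simp

theorem bracket_single {d e : ZMod 2 × ℤ} (A : F.VectHom d) (B : F.VectHom e) :
    F.bracket (F.single d A) (F.single e B) = F.single (d + e) (F.bracketHom d e A B) := by
  simp [bracket, DirectSum.toModule_lof]

theorem bracket_mem_degreesIn {s t r : Set (ZMod 2 × ℤ)} (h : ∀ d ∈ s, ∀ e ∈ t, d + e ∈ r)
    {A B : F.Vect} (hA : A ∈ F.degreesIn s) (hB : B ∈ F.degreesIn t) :
    F.bracket A B ∈ F.degreesIn r := by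
  refine degreesIn_induction ?_ ?_ ?_ A hA
  · simp
  · intro A A' hA hA'
    rw [map_add]
    exact add_mem hA hA'
  intro d hd A
  refine degreesIn_induction ?_ ?_ ?_ B hB
  · simp
  · intro A A' hA hA'
    rw [map_add]
    exact add_mem hA hA'
  intro e he B
  rw [bracket_single]
  exact single_mem_degreesIn (h d hd e he) _

theorem act_bracket {p q : ZMod 2} {A B : F.Vect} (hA : A ∈ F.ofParity p)
    (hB : B ∈ F.ofParity q) (U : Opens X) (f : F.fn U) :
    F.act U (F.bracket A B) f =
      F.act U A (F.act U B f) - sgn (p * q) • F.act U B (F.act U A f) := by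
  refine degreesIn_induction ?_ ?_ ?_ A (mem_ofParity_iff.1 hA)
  · simp
  · intro A A' hA hA'
    simp only [map_add, LinearMap.add_apply, hA, hA', smul_add]
    abel
  rintro d rfl A
  refine degreesIn_induction ?_ ?_ ?_ B (mem_ofParity_iff.1 hB)
  · simp
  · intro A A' hA hA'
    simp only [map_add, LinearMap.add_apply, hA, hA', smul_add]
    abel
  rintro e rfl B
  rw [bracket_single]
  simp [bracketHom]

theorem smul_single {d e : ZMod 2 × ℤ} {f : F.fn ⊤} (hf : f ∈ F.homog ⊤ e) (A : F.VectHom d) :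
    F.smul f (F.single d A) = F.single (e + d) (F.smulHom e d ⟨f, hf⟩ A) := by
  simp only [smul, LinearMap.comp_apply, LinearEquiv.coe_coe, DirectSum.decomposeLinearEquiv_apply]
  rw [DirectSum.decompose_of_mem _ hf]
  rw [← DirectSum.lof_eq_of ℝ]
  simp [DirectSum.toModule_lof]

theorem smul_mem_degreesIn {s t : Set (ZMod 2 × ℤ)} {e : ZMod 2 × ℤ} (h : ∀ d ∈ s, e + d ∈ t)
    {f : F.fn ⊤} (hf : f ∈ F.homog ⊤ e) {A : F.Vect} (hA : A ∈ F.degreesIn s) :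
    F.smul f A ∈ F.degreesIn t := by
  refine degreesIn_induction ?_ ?_ ?_ A hA
  · simp
  · intro A A' hA hA'
    rw [map_add]
    exact add_mem hA hA'
  intro d hd A
  rw [smul_single hf]
  exact single_mem_degreesIn (h d hd) _

theorem act_smul (f : F.fn ⊤) (A : F.Vect) (U : Opens X) (g : F.fn U) :
    F.act U (F.smul f A) g = F.res le_top f * F.act U A g := by
  refine DirectSum.Decomposition.inductionOn (F.homog ⊤) (by simp) (fun {e} f => ?_)
    (fun f g hf hg => by simp [hf, hg, add_mul]) f
  refine degreesIn_induction (s := Set.univ) ?_ ?_ ?_ A (mem_degreesIn_univ A)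
  · simp
  · intro A A' hA hA'
    simp only [map_add, LinearMap.add_apply, hA, hA', mul_add]
  intro d _ A
  rw [smul_single f.2]
  simp [smulHom]

theorem projNeg_of_mem_neg {A : F.Vect} (hA : A ∈ F.neg) : F.projNeg A = A := by
  refine DFinsupp.ext fun d => ?_
  change DFinsupp.filter _ A d = A d
  rw [DFinsupp.filter_apply]
  split_ifs with h
  · rfl
  · exact (hA d (not_lt.1 h)).symm

theorem projNeg_of_ofWeight {n : ℤ} (hn : 0 ≤ n) {A : F.Vect} (hA : A ∈ F.ofWeight n) :
    F.projNeg A = 0 := by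
  refine DFinsupp.ext fun d => ?_
  change DFinsupp.filter _ A d = 0
  rw [DFinsupp.filter_apply]
  split_ifs with h
  · exact hA d (by omega)
  · rfl

theorem projNeg_mem_neg (A : F.Vect) : F.projNeg A ∈ F.neg := by
  intro d hd
  change DFinsupp.filter _ A d = 0
  rw [DFinsupp.filter_apply, if_neg (not_lt.2 hd)]

theorem projNeg_mem_degreesIn {s : Set (ZMod 2 × ℤ)} {A : F.Vect} (hA : A ∈ F.degreesIn s) :
    F.projNeg A ∈ F.degreesIn s := by
  intro d hd
  change DFinsupp.filter _ A d = 0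
  rw [DFinsupp.filter_apply]
  split_ifs with h
  · exact hA d hd
  · rfl

end GradedSheaf

/-! ### Weights of monomials and the absence of functions of negative weight. -/

namespace GradedSheaf

variable {X : Type u} [TopologicalSpace X] {F : GradedSheaf.{u, v} X}

theorem mon_succ {k : ℕ} {U : Opens X} (y : Fin (k + 1) → F.fn U) (μ : Fin (k + 1) → ℕ) :
    F.mon y μ = y 0 ^ μ 0 * F.mon (fun i => y i.succ) (fun i => μ i.succ) := by
  simp [mon, List.ofFn_succ]

theorem mon_zero {U : Opens X} (y : Fin 0 → F.fn U) (μ : Fin 0 → ℕ) : F.mon y μ = 1 := by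
  simp [mon]

theorem mon_mem {k : ℕ} {U : Opens X} {y : Fin k → F.fn U} {e : Fin k → ZMod 2 × ℤ}
    (hy : ∀ i, y i ∈ F.homog U (e i)) (μ : Fin k → ℕ) :
    F.mon y μ ∈ F.homog U (∑ i, μ i • e i) := by
  induction k with
  | zero =>
    rw [mon_zero]
    simpa using SetLike.one_mem_graded (F.homog U)
  | succ k ih =>
    rw [mon_succ, Fin.sum_univ_succ]
    exact SetLike.mul_mem_graded (SetLike.pow_mem_graded _ (hy 0)) (ih (fun i => hy i.succ) _)

namespace Chart

variable {D : GradedDim} (c : F.Chart D)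

/-- The degree of a monomial. -/
def _root_.GradedDim.Mono.degree (μ : D.Mono) : ZMod 2 × ℤ :=
  ∑ i, μ.1 i • ((D.par i, (D.wt i : ℤ)) : ZMod 2 × ℤ)

theorem _root_.GradedDim.Mono.degree_snd (μ : D.Mono) :
    μ.degree.2 = ((∑ i, μ.1 i * D.wt i : ℕ) : ℤ) := by
  simp [GradedDim.Mono.degree, Prod.snd_sum]

/-- The function `g(x) y^μ` over `U`. -/
noncomputable def term (U : Opens (EuclideanSpace ℝ (Fin D.baseDim))) (hU : U ≤ c.target) (μ : D.Mono)
    (g : SmoothFn D.baseDim U) : F.fn (pre c.φ U) :=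
  c.σ U hU g * F.mon (fun i => F.res (pre_mono c.φ hU) (c.y i)) μ.1

theorem term_mem (U : Opens (EuclideanSpace ℝ (Fin D.baseDim))) (hU : U ≤ c.target)
    (μ : D.Mono) (g : SmoothFn D.baseDim U) :
    c.term U hU μ g ∈ F.homog _ μ.degree := by
  have := SetLike.mul_mem_graded (c.σ_homog U hU g)
    (mon_mem (fun i => F.res_homog (pre_mono c.φ hU) _ _ (c.y_homog i)) μ.1)
  rwa [show ((0, 0) : ZMod 2 × ℤ) = 0 from rfl, zero_add] at this

/-- A homogeneous function is a sum of terms of the same degree. -/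
theorem exists_sum_term {U : Opens (EuclideanSpace ℝ (Fin D.baseDim))} (hU : U ≤ c.target)
    {d : ZMod 2 × ℤ} {f : F.fn (pre c.φ U)} (hf : f ∈ F.homog _ d) :
    ∃ s : D.Mono →₀ SmoothFn D.baseDim U, (∀ μ ∈ s.support, μ.degree = d) ∧
      f = s.sum (c.term U hU) := by
  classical
  obtain ⟨s, rfl⟩ := (c.bijective U hU).2 f
  refine ⟨s.filter fun μ => μ.degree = d, fun μ hμ => by
    simp only [Finsupp.support_filter, Finset.mem_filter] at hμ
    exact hμ.2, ?_⟩
  -- Projecting to degree `d` fixes the homogeneous `f` and removes exactly the terms of other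
  -- degrees.
  rw [← DirectSum.decompose_of_mem_same _ hf]
  change ((DirectSum.decompose (F.homog (pre c.φ U)) (s.sum (c.term U hU)) d :
    F.homog (pre c.φ U) d) : F.fn (pre c.φ U)) = _
  rw [Finsupp.sum, Finsupp.sum, DirectSum.decompose_sum, DFinsupp.finsetSum_apply,
    AddSubmonoidClass.coe_finsetSum, Finsupp.support_filter, Finset.sum_filter]
  refine Finset.sum_congr rfl fun μ _ => ?_
  split_ifs with h
  · rw [Finsupp.filter_apply, if_pos h]
    subst h
    exact DirectSum.decompose_of_mem_same _ (c.term_mem U hU μ _)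
  · exact DirectSum.decompose_of_mem_ne _ (c.term_mem U hU μ _) h

/-- The weight of a monomial is a sum of natural numbers, so the expansion has no terms. -/
theorem homog_eq_bot_of_neg {U : Opens (EuclideanSpace ℝ (Fin D.baseDim))} (hU : U ≤ c.target)
    {d : ZMod 2 × ℤ} (hd : d.2 < 0) : F.homog (pre c.φ U) d = ⊥ := by
  rw [Submodule.eq_bot_iff]
  intro f hf
  obtain ⟨s, hs, rfl⟩ := c.exists_sum_term hU hf
  refine Finset.sum_eq_zero fun μ hμ => ?_
  have := μ.degree_snd
  rw [hs μ hμ] at this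
  omega

/-- The part of `U` in the domain of the coordinate system, in coordinates. -/
def image (U : Opens X) : Opens (EuclideanSpace ℝ (Fin D.baseDim)) :=
  ⟨c.φ.target ∩ c.φ.symm ⁻¹' U, c.φ.isOpen_inter_preimage_symm U.2⟩

theorem image_le (U : Opens X) : c.image U ≤ c.target := fun _ hx => hx.1

theorem mem_pre_image {U : Opens X} {x : X} :
    x ∈ pre c.φ (c.image U) ↔ x ∈ c.dom ∧ x ∈ U := by
  constructor
  · rintro ⟨h1, h2, h3⟩
    refine ⟨⟨h1, h2⟩, ?_⟩
    simpa [c.φ.left_inv h1] using h3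
  · rintro ⟨⟨h1, h2⟩, h3⟩
    refine ⟨h1, h2, ?_⟩
    simpa [c.φ.left_inv h1] using h3

end Chart

/-- A homogeneous function that vanishes locally is zero. -/
theorem eq_zero_of_locally {U : Opens X} {d : ZMod 2 × ℤ} {f : F.fn U} (hf : f ∈ F.homog U d)
    (h : ∀ x ∈ U, ∃ V : Opens X, ∃ hV : V ≤ U, x ∈ V ∧ F.res hV f = 0) : f = 0 := by
  -- `glue` speaks of sections over `⨆ j, W j`; with the cover arbitrary, `U` can be substituted by
  -- it. Uniqueness of gluing then compares `f` with `0`.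
  have key : ∀ {J : Type u} (W : J → Opens X) (_ : U = ⨆ j, W j) (hWU : ∀ j, W j ≤ U),
      (∀ j, F.res (hWU j) f = 0) → f = 0 := by
    rintro J W rfl hWU h0
    exact (F.glue d W (fun _ => 0) (fun _ => zero_mem _) (fun _ _ => by simp)).unique
      ⟨hf, h0⟩ ⟨zero_mem _, fun _ => map_zero _⟩
  choose V hV hx h0 using h
  exact key (fun x : U => V x.1 x.2)
    (le_antisymm (fun x hxU => Opens.mem_iSup.2 ⟨⟨x, hxU⟩, hx x hxU⟩)
      (iSup_le fun x => hV x.1 x.2)) (fun x => hV x.1 x.2) (fun x => h0 x.1 x.2)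

end GradedSheaf

namespace GradedManifold

variable {X : Type u} [TopologicalSpace X] [T2Space X] [SecondCountableTopology X]
  {D : GradedDim} (F : GradedManifold.{u, v} X D)

/-- There are no functions of negative weight. -/
theorem homog_eq_bot_of_neg (U : Opens X) {d : ZMod 2 × ℤ} (hd : d.2 < 0) :
    F.homog U d = ⊥ := by
  rw [Submodule.eq_bot_iff]
  intro f hf
  refine GradedSheaf.eq_zero_of_locally hf fun x hx => ?_
  obtain ⟨c, hc⟩ := F.exists_chart x
  have hV : GradedSheaf.pre c.φ (c.image U) ≤ U := fun x hx => (c.mem_pre_image.1 hx).2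
  refine ⟨_, hV, c.mem_pre_image.2 ⟨hc, hx⟩, ?_⟩
  have := F.res_homog hV d f hf
  rwa [c.homog_eq_bot_of_neg (c.image_le U) hd, Submodule.mem_bot] at this

end GradedManifold

/-! ### Leibniz rules for the superbracket. -/

namespace GradedSheaf

variable {X : Type u} [TopologicalSpace X] {F : GradedSheaf.{u, v} X}

theorem sgn_mul_self (p : ZMod 2) : sgn p * sgn p = 1 := by
  rcases sgn_eq_or p with h | h <;> simp [h]

theorem smul_mem_ofParity {e : ZMod 2 × ℤ} {f : F.fn ⊤} (hf : f ∈ F.homog ⊤ e) {p : ZMod 2}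
    {A : F.Vect} (hA : A ∈ F.ofParity p) : F.smul f A ∈ F.ofParity (e.1 + p) :=
  mem_ofParity_iff.2 <| smul_mem_degreesIn (fun d (hd : d.1 = p) => by simp [hd]) hf
    (mem_ofParity_iff.1 hA)

theorem bracket_mem_ofParity {p q : ZMod 2} {A B : F.Vect} (hA : A ∈ F.ofParity p)
    (hB : B ∈ F.ofParity q) : F.bracket A B ∈ F.ofParity (p + q) :=
  mem_ofParity_iff.2 <| bracket_mem_degreesIn
    (fun d (hd : d.1 = p) e (he : e.1 = q) => by simp [hd, he])
    (mem_ofParity_iff.1 hA) (mem_ofParity_iff.1 hB)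

/-- `[A, f B] = (A f) B ± f [A, B]`. -/
theorem bracket_smul {p : ZMod 2} {A : F.Vect} (hA : A ∈ F.ofParity p) {e : ZMod 2 × ℤ}
    {f : F.fn ⊤} (hf : f ∈ F.homog ⊤ e) (B : F.Vect) :
    F.bracket A (F.smul f B) =
      F.smul (F.act ⊤ A f) B + sgn (p * e.1) • F.smul f (F.bracket A B) := by
  refine degreesIn_induction (s := Set.univ) ?_ ?_ ?_ B (mem_degreesIn_univ B)
  · simp
  · intro B B' hB hB'
    simp only [map_add, hB, hB', smul_add]
    abel
  intro d _ B
  have hB : F.single d B ∈ F.ofParity d.1 :=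
    mem_ofParity_iff.2 (single_mem_degreesIn (Set.mem_ofPred_eq ▸ rfl) B)
  -- The action is faithful, so the identity may be tested on functions.
  refine act_injective fun U g => ?_
  rw [act_bracket hA (smul_mem_ofParity hf hB)]
  simp only [map_add, map_smul, LinearMap.add_apply, LinearMap.smul_apply, act_smul,
    act_bracket hA hB, act_mul hA (F.res_homog le_top e f hf), act_res, mul_add, sgn_add,
    mul_sub, smul_sub, mul_smul_comm, smul_smul]
  abel

/-- `[f A, B] = f [A, B] ± (B f) A`. -/
theorem smul_bracket {p r : ZMod 2} {A B : F.Vect} (hA : A ∈ F.ofParity p)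
    (hB : B ∈ F.ofParity r) {e : ZMod 2 × ℤ} {f : F.fn ⊤} (hf : f ∈ F.homog ⊤ e) :
    F.bracket (F.smul f A) B =
      F.smul f (F.bracket A B) - sgn ((e.1 + p) * r) • F.smul (F.act ⊤ B f) A := by
  refine act_injective fun U g => ?_
  rw [act_bracket (smul_mem_ofParity hf hA) hB]
  simp only [map_sub, map_smul, LinearMap.sub_apply, LinearMap.smul_apply, act_smul,
    act_bracket hA hB, act_mul hB (F.res_homog le_top e f hf), act_res, smul_add, add_mul, sgn_add,
    mul_sub, mul_smul_comm, smul_smul]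
  -- The sign of moving `B` past `f` occurs squared in the term `f · B(A g)`, which leaves the sign
  -- needed by `f [A, B]`.
  rw [mul_comm r e.1, mul_right_comm, sgn_mul_self, one_mul]
  abel

end GradedSheaf

/-! ### The anchor, the new bracket and `δf`. -/

namespace GradedManifold

open GradedSheaf

variable {X : Type u} [TopologicalSpace X] [T2Space X] [SecondCountableTopology X]
  {D : GradedDim} {F : GradedManifold.{u, v} X D}

/-- Vector fields of negative weight annihilate the functions of weight `0`. -/
theorem act_neg_eq_zero {A : F.Vect} (hA : A ∈ F.neg) {U : Opens X} {q : ZMod 2} {f : F.fn U}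
    (hf : f ∈ F.homog U (q, 0)) : F.act U A f = 0 := by
  -- The degree `(0, -1)` is merely one without nonzero functions; every component of `A` falls
  -- under the second alternative of `act_mem`.
  rw [← Submodule.mem_bot ℝ, ← F.homog_eq_bot_of_neg U (d := (0, -1)) (by simp)]
  exact act_mem (mem_below_iff.1 hA)
    (fun d (hd : d.2 < 0) => Or.inr (F.homog_eq_bot_of_neg U (by simpa using hd))) hf

variable {Q : F.Vect}

theorem homological_degree (hQ : F.IsHomological Q) : Q ∈ F.degreesIn {d | d.1 = 1 ∧ d.2 = 1} :=
  degreesIn_inf (mem_ofParity_iff.1 hQ.odd) (mem_ofWeight_iff.1 hQ.weight)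

theorem act_homological_mem (hQ : F.IsHomological Q) {U : Opens X} {q : ZMod 2} {n : ℤ}
    {f : F.fn U} (hf : f ∈ F.homog U (q, n)) : F.act U Q f ∈ F.homog U (1 + q, 1 + n) :=
  act_mem (homological_degree hQ)
    (fun d hd => Or.inl (Prod.ext (by simp [hd.1]) (by simp [hd.2]))) hf

theorem bracket_homological_below (hQ : F.IsHomological Q) {k : ℤ} {u : F.Vect}
    (hu : u ∈ F.below k) : F.bracket Q u ∈ F.below (k + 1) :=
  mem_below_iff.2 <| bracket_mem_degreesIn (s := {d | d.1 = 1 ∧ d.2 = 1})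
    (fun d hd e (he : e.2 < k) => by
      have := hd.2
      simp only [Set.mem_ofPred_eq, Prod.snd_add]
      omega)
    (homological_degree hQ) (mem_below_iff.1 hu)

theorem bracket_homological_ofWeight (hQ : F.IsHomological Q) {n : ℤ} {u : F.Vect}
    (hu : u ∈ F.ofWeight n) : F.bracket Q u ∈ F.ofWeight (n + 1) :=
  mem_ofWeight_iff.2 <| bracket_mem_degreesIn (s := {d | d.1 = 1 ∧ d.2 = 1})
    (fun d hd e (he : e.2 = n) => by
      have := hd.2
      simp only [Set.mem_ofPred_eq, Prod.snd_add]
      omega)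
    (homological_degree hQ) (mem_ofWeight_iff.1 hu)

/-- Being in `below k` means weights at most `k - 1`, so the bracket has weights at most `k + l - 2
≤ m - 1`. Two fields of negative weight thus have a bracket in `below (-1)`. -/
theorem bracket_below {k l m : ℤ} (h : k + l ≤ m + 1) {u v : F.Vect} (hu : u ∈ F.below k)
    (hv : v ∈ F.below l) : F.bracket u v ∈ F.below m :=
  mem_below_iff.2 <| bracket_mem_degreesIn
    (fun d (hd : d.2 < k) e (he : e.2 < l) => by
      simp only [Set.mem_ofPred_eq, Prod.snd_add]
      omega)
    (mem_below_iff.1 hu) (mem_below_iff.1 hv)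

theorem smul_below {k : ℤ} {q : ZMod 2} {f : F.fn ⊤} (hf : f ∈ F.homog ⊤ (q, 0)) {u : F.Vect}
    (hu : u ∈ F.below k) : F.smul f u ∈ F.below k :=
  mem_below_iff.2 <| smul_mem_degreesIn (fun d (hd : d.2 < k) => by simpa using hd) hf
    (mem_below_iff.1 hu)

theorem smul_ofWeight {n : ℤ} {q : ZMod 2} {f : F.fn ⊤} (hf : f ∈ F.homog ⊤ (q, 0)) {u : F.Vect}
    (hu : u ∈ F.ofWeight n) : F.smul f u ∈ F.ofWeight n :=
  mem_ofWeight_iff.2 <| smul_mem_degreesIn (fun d (hd : d.2 = n) => by simpa using hd) hf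
    (mem_ofWeight_iff.1 hu)

/-- Since `[Q, u]` has weights at most `0` and `v` at most `-1`, the bracket already has negative
weight. -/
theorem newBracket_eq (hQ : F.IsHomological Q) {u v : F.Vect} (hu : u ∈ F.neg)
    (hv : v ∈ F.neg) : F.newBracket Q u v = F.bracket (F.bracket Q u) v :=
  projNeg_of_mem_neg (bracket_below (by simp) (bracket_homological_below hQ hu) hv)

theorem anchor_mem (hQ : F.IsHomological Q) {p : ZMod 2} {u : F.Vect}
    (hu : u ∈ F.neg ⊓ F.ofParity p) {U : Opens X} {q : ZMod 2} {f : F.fn U}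
    (hf : f ∈ F.homog U (q, 0)) : F.anchor Q u U f ∈ F.homog U (p + 1 + q, 0) := by
  have h := degreesIn_inf (mem_ofParity_iff.1 (bracket_mem_ofParity hQ.odd hu.2))
    (mem_below_iff.1 (bracket_homological_below hQ hu.1))
  refine act_mem h (fun d hd => ?_) hf
  have h1 : d.1 = 1 + p := hd.1
  have h2 : d.2 < 0 + 1 := hd.2
  rcases (show d.2 ≤ 0 by omega).lt_or_eq with h2 | h2
  · exact Or.inr (F.homog_eq_bot_of_neg U (by simpa using h2))
  · exact Or.inl (Prod.ext (by simp [h1, add_comm]) (by simp [h2]))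

theorem anchor_mul (hQ : F.IsHomological Q) {p : ZMod 2} {u : F.Vect} (hu : u ∈ F.ofParity p)
    {U : Opens X} {q : ZMod 2} {f : F.fn U} (hf : f ∈ F.homog U (q, 0)) (g : F.fn U) :
    F.anchor Q u U (f * g) =
      F.anchor Q u U f * g + sgn ((p + 1) * q) • (f * F.anchor Q u U g) := by
  rw [add_comm p 1]
  exact act_mul (bracket_mem_ofParity hQ.odd hu) hf g

theorem newBracket_smul_right (hQ : F.IsHomological Q) {p q : ZMod 2} {u : F.Vect}
    (hu : u ∈ F.neg ⊓ F.ofParity p) {f : F.fn ⊤} (hf : f ∈ F.homog ⊤ (q, 0)) {v : F.Vect}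
    (hv : v ∈ F.neg) :
    F.newBracket Q u (F.smul f v) =
      F.smul (F.anchor Q u ⊤ f) v + sgn ((p + 1) * q) • F.smul f (F.newBracket Q u v) := by
  rw [newBracket_eq hQ hu.1 hv, newBracket_eq hQ hu.1 (smul_below hf hv), add_comm p 1]
  exact bracket_smul (bracket_mem_ofParity hQ.odd hu.2) hf v

/-- For weights at most `-2`, both `[Q, w]` and `[Q, f w]` stay in negative weight, so the
projectors drop out and the Leibniz rule applies. -/
theorem delta_below (hQ : F.IsHomological Q) {q : ZMod 2} {f : F.fn ⊤}
    (hf : f ∈ F.homog ⊤ (q, 0)) {w : F.Vect} (hw : w ∈ F.below (-1)) :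
    F.delta Q q f w = F.smul (F.act ⊤ Q f) w := by
  simp only [delta, diff, LinearMap.sub_apply, LinearMap.smul_apply, LinearMap.comp_apply]
  rw [projNeg_of_mem_neg (bracket_homological_below hQ (smul_below hf hw)),
    projNeg_of_mem_neg (bracket_homological_below hQ hw), bracket_smul hQ.odd hf, one_mul]
  abel

/-- Both `[Q, w]` and `[Q, f w]` have weight `0`, so the projector kills them. -/
theorem delta_weight_neg_one (hQ : F.IsHomological Q) {q : ZMod 2} {f : F.fn ⊤}
    (hf : f ∈ F.homog ⊤ (q, 0)) {w : F.Vect} (hw : w ∈ F.ofWeight (-1)) :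
    F.delta Q q f w = 0 := by
  simp only [delta, diff, LinearMap.sub_apply, LinearMap.smul_apply, LinearMap.comp_apply]
  rw [projNeg_of_ofWeight le_rfl (bracket_homological_ofWeight hQ (smul_ofWeight hf hw)),
    projNeg_of_ofWeight le_rfl (bracket_homological_ofWeight hQ hw)]
  simp

theorem delta_neg {q : ZMod 2} {f : F.fn ⊤}
    (hf : f ∈ F.homog ⊤ (q, 0)) (w : F.Vect) : F.delta Q q f w ∈ F.neg :=
  sub_mem (projNeg_mem_neg _)
    (Submodule.smul_mem _ _ (smul_below hf (projNeg_mem_neg _)))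

theorem delta_ofParity (hQ : F.IsHomological Q) {q r : ZMod 2} {f : F.fn ⊤}
    (hf : f ∈ F.homog ⊤ (q, 0)) {w : F.Vect} (hw : w ∈ F.ofParity r) :
    F.delta Q q f w ∈ F.ofParity (q + 1 + r) := by
  refine sub_mem ?_ (Submodule.smul_mem _ _ ?_)
  · rw [add_comm q 1, add_assoc]
    exact projNeg_mem_degreesIn (bracket_mem_ofParity hQ.odd (smul_mem_ofParity hf hw))
  · rw [add_assoc]
    exact smul_mem_ofParity hf (projNeg_mem_degreesIn (bracket_mem_ofParity hQ.odd hw))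

theorem delta_ofWeight (hQ : F.IsHomological Q) {q : ZMod 2} {n : ℤ} {f : F.fn ⊤}
    (hf : f ∈ F.homog ⊤ (q, 0)) {w : F.Vect} (hw : w ∈ F.ofWeight n) :
    F.delta Q q f w ∈ F.ofWeight (n + 1) :=
  sub_mem (projNeg_mem_degreesIn (bracket_homological_ofWeight hQ (smul_ofWeight hf hw)))
    (Submodule.smul_mem _ _
      (smul_ofWeight hf (projNeg_mem_degreesIn (bracket_homological_ofWeight hQ hw))))

theorem newBracket_smul_left (hQ : F.IsHomological Q) {p q r : ZMod 2} {f : F.fn ⊤}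
    (hf : f ∈ F.homog ⊤ (q, 0)) {u v : F.Vect} (hu : u ∈ F.neg ⊓ F.ofParity p)
    (hv : v ∈ F.neg ⊓ F.ofParity r) :
    F.newBracket Q (F.smul f u) v =
      sgn q • F.smul f (F.newBracket Q u v) +
        sgn ((q + p) * r) • F.smul (F.anchor Q v ⊤ f) u +
        F.delta Q q f (F.bracket u v) := by
  have hvf : F.act ⊤ v f = 0 := act_neg_eq_zero hv.1 hf
  -- In `[Q, v] f` the summand `Q (v f)` vanishes; this turns the term `v (Q f) · u` of `[Qf · u,
  -- v]` into the anchor term.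
  have hvQ : F.anchor Q v ⊤ f = -(sgn r • F.act ⊤ v (F.act ⊤ Q f)) := by
    rw [anchor, act_bracket hQ.odd hv.2, hvf, map_zero, one_mul, zero_sub]
  have h1 := bracket_smul hQ.odd hf u
  have h2 := smul_bracket hu.2 hv.2 (act_homological_mem hQ hf)
  have h3 := smul_bracket (bracket_mem_ofParity hQ.odd hu.2) hv.2 hf
  rw [newBracket_eq hQ hu.1 hv.1, newBracket_eq hQ (smul_below hf hu.1) hv.1,
    delta_below hQ hf (bracket_below (by simp) hu.1 hv.1)]
  refine (congrArg (fun A => F.bracket A v) h1).trans ?_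
  simp only [map_add, LinearMap.add_apply, map_smul, LinearMap.smul_apply]
  refine (congrArg₂ (fun A B => A + sgn (1 * q) • B) h2 h3).trans ?_
  simp only [hvf, hvQ, map_zero, LinearMap.zero_apply, smul_zero, sub_zero, one_mul, map_neg,
    map_smul, LinearMap.neg_apply, LinearMap.smul_apply, add_mul, sgn_add]
  module

end GradedManifold

/-! ### Hadamard's lemma for smooth functions. -/

open MeasureTheory Set Filter Topology in
/-- A smooth integrand gives an integral that depends smoothly on the parameter. -/
theorem contDiff_parametric_integral {P E : Type} [NormedAddCommGroup P] [NormedSpace ℝ P]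
    [FiniteDimensional ℝ P] [NormedAddCommGroup E] [NormedSpace ℝ E] {G : P × ℝ → E}
    (hG : ContDiff ℝ ∞ G) (n : ℕ) : ContDiff ℝ n fun x => ∫ t in (0 : ℝ)..1, G (x, t) := by
  induction n generalizing E with
  | zero =>
    rw [Nat.cast_zero, contDiff_zero]
    exact intervalIntegral.continuous_parametric_intervalIntegral_of_continuous'
      (f := fun x t => G (x, t)) hG.continuous 0 1
  | succ n ih =>
    have : ProperSpace P := FiniteDimensional.proper ℝ P
    -- The derivative of the integral is the integral of the partial derivative `G'`, again smooth
    -- but with values in `P →L[ℝ] E`; hence the induction over all `E`.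
    let G' : P × ℝ → P →L[ℝ] E := fun z => (fderiv ℝ G z).comp (ContinuousLinearMap.inl ℝ P ℝ)
    have hG' : ContDiff ℝ ∞ G' :=
      (hG.fderiv_right (m := ∞) le_rfl).clm_comp contDiff_const
    have hder : ∀ x t, HasFDerivAt (fun x => G (x, t)) (G' (x, t)) x := fun x t =>
      ((hG.differentiable (by simp)) (x, t)).hasFDerivAt.comp x (hasFDerivAt_prodMk_left x t)
    have key : ∀ x, HasFDerivAt (fun x => ∫ t in (0 : ℝ)..1, G (x, t))
        (∫ t in (0 : ℝ)..1, G' (x, t)) x := by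
      intro x
      -- Compactness bounds `G'` by a constant, the dominating function for differentiation under
      -- the integral.
      obtain ⟨C, hC⟩ := ((isCompact_closedBall x 1).prod (isCompact_Icc (a := (0 : ℝ))
        (b := 1))).exists_bound_of_continuousOn hG'.continuous.continuousOn
      refine intervalIntegral.hasFDerivAt_integral_of_dominated_of_fderiv_le (𝕜 := ℝ)
        (F := fun x t => G (x, t)) (F' := fun x t => G' (x, t)) (bound := fun _ => C)
        (Metric.closedBall_mem_nhds x one_pos) ?_ ?_ ?_ ?_ ?_ ?_
      · exact Eventually.of_forall fun y =>
          (hG.continuous.comp (Continuous.prodMk_right y)).aestronglyMeasurable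
      · exact (hG.continuous.comp (Continuous.prodMk_right x)).intervalIntegrable _ _
      · exact (hG'.continuous.comp (Continuous.prodMk_right x)).aestronglyMeasurable
      · refine Eventually.of_forall fun t ht y hy => hC (y, t) ⟨hy, ?_⟩
        rw [uIoc_of_le zero_le_one] at ht
        exact ⟨ht.1.le, ht.2⟩
      · exact intervalIntegrable_const
      · exact Eventually.of_forall fun t _ y _ => hder y t
    rw [Nat.cast_succ, contDiff_succ_iff_hasFDerivAt]
    exact ⟨_, ih hG', key⟩

namespace SmoothFn

variable {n : ℕ} {U : Opens (EuclideanSpace ℝ (Fin n))}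

theorem extend_apply (g : SmoothFn n U) (x : U) :
    Function.extend Subtype.val g (0 : EuclideanSpace ℝ (Fin n) → ℝ) x = g x :=
  Subtype.val_injective.extend_apply _ _ _

theorem contDiffAt_extend (g : SmoothFn n U) {x : EuclideanSpace ℝ (Fin n)} (hx : x ∈ U) :
    ContDiffAt ℝ ∞ (Function.extend Subtype.val g (0 : EuclideanSpace ℝ (Fin n) → ℝ)) x := by
  rw [← contMDiffAt_iff_contDiffAt, ← contMDiffAt_subtype_iff (U := U) (x := ⟨x, hx⟩)]
  have : (fun y : U => Function.extend Subtype.val g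
      (0 : EuclideanSpace ℝ (Fin n) → ℝ) (y : EuclideanSpace ℝ (Fin n))) = g :=
    funext fun y => g.extend_apply y
  rw [this]
  exact g.contMDiff _

/-- The restriction of a smooth function on `ℝⁿ` to an open subset. -/
def ofContDiff (U : Opens (EuclideanSpace ℝ (Fin n))) {f : EuclideanSpace ℝ (Fin n) → ℝ}
    (hf : ContDiff ℝ ∞ f) : SmoothFn n U :=
  ⟨fun x => f x, hf.contMDiff.comp contMDiff_subtype_val⟩

@[simp]
theorem ofContDiff_apply {f : EuclideanSpace ℝ (Fin n) → ℝ} (hf : ContDiff ℝ ∞ f) (x : U) :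
    ofContDiff U hf x = f x := rfl

open Filter Topology in
/-- A smooth function on an open set agrees, near a given point, with a smooth function on `ℝⁿ`. -/
theorem exists_contDiff_eventuallyEq (g : SmoothFn n U) {p : EuclideanSpace ℝ (Fin n)}
    (hp : p ∈ U) : ∃ f : EuclideanSpace ℝ (Fin n) → ℝ, ContDiff ℝ ∞ f ∧
      f =ᶠ[𝓝 p] Function.extend Subtype.val g (0 : EuclideanSpace ℝ (Fin n) → ℝ) := by
  obtain ⟨r, hr, hrU⟩ := Metric.nhds_basis_closedBall.mem_iff.1 (U.2.mem_nhds hp)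
  -- The cutoff is `1` near `p` and supported in a closed ball inside `U`, so it makes the extension
  -- by zero smooth everywhere.
  let χ : ContDiffBump p := ⟨r / 2, r, half_pos hr, half_lt_self hr⟩
  refine ⟨fun x => χ x * Function.extend Subtype.val g 0 x, ?_, ?_⟩
  · rw [contDiff_iff_contDiffAt]
    intro x
    by_cases hx : x ∈ U
    · exact χ.contDiff.contDiffAt.mul (g.contDiffAt_extend hx)
    · have hx' : x ∉ tsupport χ := by
        rw [χ.tsupport_eq]
        exact fun h => hx (hrU h)
      refine (contDiffAt_const (c := (0 : ℝ))).congr_of_eventuallyEq ?_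
      filter_upwards [notMem_tsupport_iff_eventuallyEq.1 hx'] with y hy
      simp [hy]
  · filter_upwards [χ.eventuallyEq_one] with y hy
    simp [hy]

open Filter Topology MeasureTheory in
/-- Hadamard's lemma. -/
theorem exists_hadamard {f : EuclideanSpace ℝ (Fin n) → ℝ} (hf : ContDiff ℝ ∞ f)
    (p : EuclideanSpace ℝ (Fin n)) :
    ∃ h : Fin n → EuclideanSpace ℝ (Fin n) → ℝ, (∀ a, ContDiff ℝ ∞ (h a)) ∧
      (∀ x, f x = f p + ∑ a, (x a - p a) * h a x) ∧
      ∀ a, h a p = fderiv ℝ f p (EuclideanSpace.single a 1) := by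
  have hsm : ContDiff ℝ ∞ fun z : EuclideanSpace ℝ (Fin n) × ℝ =>
      fderiv ℝ f (p + z.2 • (z.1 - p)) :=
    (hf.fderiv_right (m := ∞) le_rfl).comp
      (contDiff_const.add (contDiff_snd.smul (contDiff_fst.sub contDiff_const)))
  -- `H x` averages the derivative of `f` over the segment from `p` to `x`, so `H x (x - p) = f x -
  -- f p`, and `H p` is the derivative at `p`.
  let H : EuclideanSpace ℝ (Fin n) → EuclideanSpace ℝ (Fin n) →L[ℝ] ℝ :=
    fun x => ∫ t in (0 : ℝ)..1, fderiv ℝ f (p + t • (x - p))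
  have hH : ContDiff ℝ ∞ H := contDiff_infty.2 (contDiff_parametric_integral hsm)
  refine ⟨fun a x => H x (EuclideanSpace.single a 1), fun a => hH.clm_apply contDiff_const,
    fun x => ?_, fun a => ?_⟩
  · have hcont : Continuous fun t : ℝ => fderiv ℝ f (p + t • (x - p)) :=
      hsm.continuous.comp (Continuous.prodMk_right x)
    have h1 : ∑ a, (x a - p a) * H x (EuclideanSpace.single a 1) = H x (x - p) := by
      conv_rhs => rw [← (EuclideanSpace.basisFun (Fin n) ℝ).sum_repr (x - p)]
      simp
    have h2 : H x (x - p) = ∫ t in (0 : ℝ)..1, fderiv ℝ f (p + t • (x - p)) (x - p) :=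
      ContinuousLinearMap.intervalIntegral_apply (hcont.intervalIntegrable _ _) _
    have h3 : ∀ t : ℝ, HasDerivAt (fun t : ℝ => f (p + t • (x - p)))
        (fderiv ℝ f (p + t • (x - p)) (x - p)) t := by
      intro t
      have h4 : HasDerivAt (fun t : ℝ => p + t • (x - p)) (x - p) t := by
        simpa using ((hasDerivAt_id t).smul_const (x - p)).const_add p
      exact (hf.differentiable (by simp) _).hasFDerivAt.comp_hasDerivAt t h4
    rw [h1, h2, intervalIntegral.integral_eq_sub_of_hasDerivAt (fun t _ => h3 t)
      ((hcont.clm_apply continuous_const).intervalIntegrable _ _)]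
    simp
  · simp [H]

open Topology in
/-- Hadamard's lemma for a smooth function near a point of an open set. -/
theorem exists_local_hadamard (g : SmoothFn n U) {p : EuclideanSpace ℝ (Fin n)} (hp : p ∈ U) :
    ∃ (W : Opens (EuclideanSpace ℝ (Fin n))) (hW : W ≤ U) (_ : p ∈ W) (h : Fin n → SmoothFn n W),
      (∀ x : W, g ⟨x, hW x.2⟩ = g ⟨p, hp⟩ + ∑ a, (x.1 a - p a) * h a x) ∧
      ∀ a (hpW : p ∈ W), h a ⟨p, hpW⟩ = g.partialDeriv a ⟨p, hp⟩ := by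
  obtain ⟨f, hf, hfg⟩ := g.exists_contDiff_eventuallyEq hp
  obtain ⟨h, hh, h1, h2⟩ := exists_hadamard hf p
  obtain ⟨s, hs, hso, hps⟩ := eventually_nhds_iff.1 hfg
  refine ⟨⟨s, hso⟩ ⊓ U, inf_le_right, ⟨hps, hp⟩, fun a => ofContDiff _ (hh a), fun x => ?_,
    fun a hpW => ?_⟩
  · have e1 := hs x.1 x.2.1
    have e2 := hs p hps
    rw [g.extend_apply ⟨x.1, x.2.2⟩] at e1
    rw [g.extend_apply ⟨p, hp⟩] at e2
    rw [← e1, ← e2]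
    exact h1 x
  · rw [ofContDiff_apply, h2, hfg.fderiv_eq]
    rfl

end SmoothFn

/-! ### Derivations on powers and monomials. -/

namespace GradedSheaf

variable {X : Type u} [TopologicalSpace X] {F : GradedSheaf.{u, v} X}

/-- Even functions commute with all functions. -/
theorem mul_comm_of_even {U : Opens X} {n : ℤ} {f : F.fn U} (hf : f ∈ F.homog U (0, n))
    (g : F.fn U) : f * g = g * f := by
  refine DirectSum.Decomposition.inductionOn (F.homog U) (by simp) (fun {e} g => ?_)
    (fun g h hg hh => by rw [mul_add, add_mul, hg, hh]) g
  rw [F.supercomm U (0, n) e f g hf g.2]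
  simp [sgn]

namespace VectHom

variable {δ : ZMod 2 × ℤ} (A : F.VectHom δ)

theorem map_one (U : Opens X) : A.1 U 1 = 0 := by
  have := A.2.2.2 U 0 1 1 (SetLike.one_mem_graded (F.homog U))
  simpa [sgn] using this

theorem map_algebraMap (U : Opens X) (r : ℝ) :
    A.1 U (algebraMap ℝ _ r) = 0 := by
  rw [Algebra.algebraMap_eq_smul_one, map_smul, map_one, smul_zero]

theorem map_even_mul {U : Opens X} {n : ℤ} {f : F.fn U} (hf : f ∈ F.homog U (0, n))
    (g : F.fn U) : A.1 U (f * g) = A.1 U f * g + f * A.1 U g := by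
  rw [A.2.2.2 U _ f g hf]
  simp [sgn]

/-- Even functions commute with everything, which gives the usual power rule; odd ones occur only
with exponent `0` or `1`. At `m = 0` the truncated `m - 1` is harmless, as the coefficient is `0`.
-/
theorem map_pow {U : Opens X} {e : ZMod 2 × ℤ} {f : F.fn U} (hf : f ∈ F.homog U e) {m : ℕ}
    (hm : e.1 = 1 → m ≤ 1) : A.1 U (f ^ m) = (m : ℝ) • (A.1 U f * f ^ (m - 1)) := by
  have h2 : ∀ p : ZMod 2, p = 0 ∨ p = 1 := by decide
  rcases h2 e.1 with h | h
  · have hf' : f ∈ F.homog U (0, e.2) := by rwa [← h]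
    clear hm
    induction m with
    | zero => simp [map_one]
    | succ m ih =>
      rw [pow_succ', map_even_mul A hf', ih]
      rcases m with _ | m
      · simp
      · rw [mul_smul_comm, ← mul_assoc, mul_comm_of_even hf' (A.1 U f), mul_assoc,
          Nat.add_sub_cancel, ← pow_succ']
        push_cast
        module
  · have : m = 0 ∨ m = 1 := by have := hm h; omega
    rcases this with rfl | rfl
    · simp [map_one]
    · simp

/-- The value of a homogeneous vector field on a monomial. -/
theorem map_mon {k : ℕ} {U : Opens X} {y : Fin k → F.fn U} {e : Fin k → ZMod 2 × ℤ}
    (hy : ∀ i, y i ∈ F.homog U (e i)) {μ : Fin k → ℕ} (hμ : ∀ i, (e i).1 = 1 → μ i ≤ 1) :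
    A.1 U (F.mon y μ) = ∑ i, (sgn ((e i).1 * ∑ j with j < i, (μ j : ZMod 2) * (e j).1) * (μ i : ℝ)) •
      (A.1 U (y i) * F.mon y (Function.update μ i (μ i - 1))) := by
  induction k with
  | zero => simp [mon_zero, map_one]
  | succ k ih =>
    have hpow := SetLike.pow_mem_graded (μ 0) (hy 0)
    rw [mon_succ, A.2.2.2 U _ _ _ hpow, map_pow A (hy 0) (hμ 0),
      ih (fun i => hy i.succ) (fun i => hμ i.succ), Fin.sum_univ_succ]
    congr 1
    · rw [mon_succ]
      simp [sgn, mul_assoc, Fin.succ_ne_zero, Function.update_of_ne]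
    · rw [Finset.mul_sum, Finset.smul_sum]
      refine Finset.sum_congr rfl fun i _ => ?_
      have hs : (∑ j with j < i.succ, (μ j : ZMod 2) * (e j).1) =
          (μ 0 : ZMod 2) * (e 0).1 + ∑ j with j < i, (μ j.succ : ZMod 2) * (e j.succ).1 := by
        rw [Finset.sum_filter, Fin.sum_univ_succ, Finset.sum_filter]
        simp
      have hu : F.mon y (Function.update μ i.succ (μ i.succ - 1)) = y 0 ^ μ 0 *
          F.mon (fun j => y j.succ)
            (Function.update (fun j => μ j.succ) i (μ i.succ - 1)) := by
        rw [mon_succ, Function.update_of_ne (Fin.succ_ne_zero i).symm]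
        congr 2
        funext j
        by_cases h : j = i
        · subst h
          simp
        · rw [Function.update_of_ne h, Function.update_of_ne (fun h' => h (Fin.succ_inj.1 h'))]
      -- Moving `y 0 ^ μ 0` past `A (y i.succ)`, of parity `δ.1 + (e i.succ).1`, gives a sign whose
      -- `δ`-part cancels the sign of the Leibniz rule.
      have hc := F.supercomm U _ _ _ _ hpow (A.2.2.1 U _ _ (hy i.succ))
      rw [hs, hu, mul_smul_comm, ← mul_assoc, hc, smul_mul_assoc, mul_assoc, smul_smul, smul_smul]
      congr 1
      simp only [Prod.fst_add, nsmul_eq_mul, mul_add, sgn_add]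
      rw [mul_comm δ.1, mul_comm (e i.succ).1 ((μ 0 : ZMod 2) * (e 0).1)]
      linear_combination (sgn ((e i.succ).1 * ∑ j with j < i, (μ j.succ : ZMod 2) * (e j.succ).1) *
        (μ i.succ : ℝ) * sgn ((μ 0 : ZMod 2) * (e 0).1 * (e i.succ).1)) *
          sgn_mul_self ((μ 0 : ZMod 2) * (e 0).1 * δ.1)

end VectHom

/-- A monomial of weight `1` is divisible by a coordinate of weight `1`. -/
theorem mon_eq_mul_of_weight_one {k : ℕ} {U : Opens X} {y : Fin k → F.fn U} {p : Fin k → ZMod 2}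
    {w : Fin k → ℕ} (hy : ∀ i, y i ∈ F.homog U (p i, (w i : ℤ))) {μ : Fin k → ℕ}
    (hμ : ∑ i, μ i * w i = 1) :
    ∃ i, w i = 1 ∧ ∃ d h, h ∈ F.homog U d ∧
      (p i, (w i : ℤ)) + d = ∑ i, μ i • ((p i, (w i : ℤ)) : ZMod 2 × ℤ) ∧
      F.mon y μ = y i * h := by
  induction k with
  | zero => simp at hμ
  | succ k ih =>
    rw [Fin.sum_univ_succ] at hμ
    -- Exactly one product `μ i * w i` is nonzero, and both its factors are `1`. If it is not the
    -- first, the power of `y 0` moves past `y i` and the sign is absorbed into the cofactor.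
    rcases Nat.eq_zero_or_pos (μ 0 * w 0) with h0 | h0
    · obtain ⟨i, hi, d, h, hh, hd, he⟩ := ih (fun i => hy i.succ) (μ := fun i => μ i.succ)
        (by simpa [h0] using hμ)
      have hpow := SetLike.pow_mem_graded (μ 0) (hy 0)
      refine ⟨i.succ, hi, _, _, Submodule.smul_mem _ (sgn ((μ 0 • ((p 0, (w 0 : ℤ)) :
        ZMod 2 × ℤ)).1 * p i.succ)) (SetLike.mul_mem_graded hpow hh), ?_, ?_⟩
      · rw [Fin.sum_univ_succ, ← hd]
        abel
      · rw [mon_succ, he, ← mul_assoc, F.supercomm U _ _ _ _ hpow (hy i.succ), smul_mul_assoc,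
          mul_smul_comm, mul_assoc]
    · have h1 : μ 0 * w 0 = 1 := by omega
      obtain ⟨h2, h3⟩ := mul_eq_one.1 h1
      refine ⟨0, h3, _, _, mon_mem (fun i => hy i.succ) (fun i => μ i.succ), ?_, ?_⟩
      · rw [Fin.sum_univ_succ, h2, one_smul]
      · rw [mon_succ, h2, pow_one]

end GradedSheaf

/-! ### Vector fields and functions of low weight in a chart. -/

namespace GradedSheaf

variable {X : Type u} [TopologicalSpace X] {F : GradedSheaf.{u, v} X}

theorem res_mon {k : ℕ} {U V : Opens X} (h : V ≤ U) (y : Fin k → F.fn U) (μ : Fin k → ℕ) :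
    F.res h (F.mon y μ) = F.mon (fun i => F.res h (y i)) μ := by
  simp [mon, map_list_prod, List.map_ofFn, Function.comp_def]

namespace Chart

variable {D : GradedDim} (c : F.Chart D)

section Coefficients

variable {U : Opens (EuclideanSpace ℝ (Fin D.baseDim))} (hU : U ≤ c.target)

/-- The isomorphism between families of coefficients and functions. -/
noncomputable def expand : (D.Mono →₀ SmoothFn D.baseDim U) ≃ₗ[ℝ] F.fn (pre c.φ U) :=
  LinearEquiv.ofBijective
    { toFun := fun s => s.sum (c.term U hU)
      map_add' := fun s t => by
        classical
        exact Finsupp.sum_add_index' (fun μ => by simp [term]) (fun μ g h => by simp [term, add_mul])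
      map_smul' := fun r s => by
        simp only [RingHom.id_apply]
        rw [Finsupp.sum_smul_index' (fun μ => by simp [term]), Finsupp.smul_sum]
        simp [term] }
    (c.bijective U hU)

theorem expand_apply (s : D.Mono →₀ SmoothFn D.baseDim U) :
    c.expand hU s = s.sum (c.term U hU) := rfl

theorem sigma_mul_expand (k : SmoothFn D.baseDim U) (s : D.Mono →₀ SmoothFn D.baseDim U) :
    c.σ U hU k * c.expand hU s = c.expand hU (s.mapRange (k * ·) (mul_zero k)) := by
  rw [expand_apply, expand_apply, Finsupp.sum_mapRange_index (fun μ => by simp [term]),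
    Finsupp.mul_sum]
  simp [term, mul_assoc]

/-- The functions whose coefficients all vanish at `p`. -/
def vanishing (p : U) : Submodule ℝ (F.fn (pre c.φ U)) where
  carrier := {f | ∀ μ, ((c.expand hU).symm f μ) p = 0}
  zero_mem' := fun μ => by simp
  add_mem' := fun {f g} hf hg μ => by
    rw [map_add, Finsupp.add_apply]
    exact (congrArg₂ (· + ·) (hf μ) (hg μ)).trans (add_zero 0)
  smul_mem' := fun r f hf μ => by
    rw [map_smul, Finsupp.smul_apply]
    exact (congrArg (r * ·) (hf μ)).trans (mul_zero r)

/-- Multiplication by a function of `x` acts on each coefficient separately. -/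
theorem sigma_mul_mem_vanishing {p : U} {k : SmoothFn D.baseDim U} (hk : k p = 0)
    (f : F.fn (pre c.φ U)) : c.σ U hU k * f ∈ c.vanishing hU p := by
  intro μ
  obtain ⟨s, rfl⟩ := (c.expand hU).surjective f
  rw [sigma_mul_expand, LinearEquiv.symm_apply_apply, Finsupp.mapRange_apply]
  exact (congrArg (· * s μ p) hk).trans (zero_mul _)

theorem sigma_mul_comm (k : SmoothFn D.baseDim U) (f : F.fn (pre c.φ U)) :
    c.σ U hU k * f = f * c.σ U hU k :=
  mul_comm_of_even (c.σ_homog U hU k) f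

/-- The restriction of smooth functions. -/
noncomputable abbrev restrict {V : Opens (EuclideanSpace ℝ (Fin D.baseDim))} (h : V ≤ U) :
    SmoothFn D.baseDim U →+* SmoothFn D.baseDim V :=
  ContMDiffMap.restrictRingHom 𝓘(ℝ, EuclideanSpace ℝ (Fin D.baseDim)) 𝓘(ℝ, ℝ) ℝ h

theorem res_expand {V : Opens (EuclideanSpace ℝ (Fin D.baseDim))} (h : V ≤ U)
    (s : D.Mono →₀ SmoothFn D.baseDim U) :
    F.res (pre_mono c.φ h) (c.expand hU s) =
      c.expand (h.trans hU) (s.mapRange (restrict h) (map_zero _)) := by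
  rw [expand_apply, expand_apply, Finsupp.sum_mapRange_index (fun μ => by simp [term]),
    map_finsuppSum]
  refine Finset.sum_congr rfl fun μ _ => ?_
  simp only [term, map_mul, c.σ_res U V hU h, res_mon, F.res_res]

/-- A function vanishes if, near each point, so do its coefficients at that point. -/
theorem eq_zero_of_vanishing {f : F.fn (pre c.φ U)}
    (hf : ∀ p : EuclideanSpace ℝ (Fin D.baseDim), p ∈ U →
      ∃ (V : Opens (EuclideanSpace ℝ (Fin D.baseDim))) (h : V ≤ U) (hp : p ∈ V),
        F.res (pre_mono c.φ h) f ∈ c.vanishing (h.trans hU) ⟨p, hp⟩) : f = 0 := by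
  obtain ⟨s, rfl⟩ := (c.expand hU).surjective f
  suffices s = 0 by rw [this, map_zero]
  ext μ ⟨p, hpU⟩
  obtain ⟨V, h, hp, hv⟩ := hf p hpU
  have := hv μ
  rw [c.res_expand hU h, LinearEquiv.symm_apply_apply, Finsupp.mapRange_apply] at this
  exact this

end Coefficients

/-- The coordinate `x^a`, as a smooth function on an open subset of `ℝⁿ`. -/
def coordFn (U : Opens (EuclideanSpace ℝ (Fin D.baseDim))) (a : Fin D.baseDim) :
    SmoothFn D.baseDim U :=
  ⟨fun x => (x : EuclideanSpace ℝ (Fin D.baseDim)) a,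
      ((EuclideanSpace.proj (𝕜 := ℝ) a).contMDiff).comp contMDiff_subtype_val⟩

/-- The chain rule for functions of the even coordinates of weight `0`. -/
theorem map_ofSmooth {δ : ZMod 2 × ℤ} (A : F.VectHom δ) (g : SmoothFn D.baseDim c.target) :
    A.1 c.dom (c.ofSmooth g) =
      ∑ a, A.1 c.dom (c.coord (Sum.inl a)) * c.ofSmooth (g.partialDeriv a) := by
  rw [← sub_eq_zero]
  refine c.eq_zero_of_vanishing le_rfl fun p hp => ?_
  obtain ⟨W, hW, hpW, h, h1, h2⟩ := g.exists_local_hadamard hp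
  refine ⟨W, hW, hpW, ?_⟩
  have hg : restrict hW g = algebraMap ℝ _ (g ⟨p, hp⟩) +
      ∑ a, (coordFn W a - algebraMap ℝ _ (p a)) * h a := by
    ext x
    rw [ContMDiffMap.coe_add, Pi.add_apply, ← ContMDiffMap.coeFnRingHom_apply (∑ a, _), map_sum,
      Finset.sum_apply]
    exact h1 x
  have hx : ∀ a, F.res (pre_mono c.φ hW) (c.coord (Sum.inl a)) = c.σ W hW (coordFn W a) :=
    fun a => c.σ_res _ W le_rfl hW _
  have hres : ∀ k, F.res (pre_mono c.φ hW) (c.ofSmooth k) = c.σ W hW (restrict hW k) :=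
    fun k => c.σ_res _ W le_rfl hW k
  -- By Hadamard and Leibniz, the defect near `p` is a sum of products with a factor `x^a - p^a` or
  -- `h a - ∂g/∂x^a`. Both vanish at `p`, so all coefficients of the defect do, whatever the values
  -- of `A` are.
  have key : F.res (pre_mono c.φ hW) (A.1 c.dom (c.ofSmooth g) -
      ∑ a, A.1 c.dom (c.coord (Sum.inl a)) * c.ofSmooth (g.partialDeriv a)) =
      ∑ a, (c.σ W hW (coordFn W a - algebraMap ℝ _ (p a)) * A.1 _ (c.σ W hW (h a)) +
        c.σ W hW (h a - restrict hW (g.partialDeriv a)) * A.1 _ (c.σ W hW (coordFn W a))) := by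
    simp only [map_sub, map_sum, map_mul, A.2.1, hres, hx, hg, map_add, AlgHom.commutes,
      VectHom.map_algebraMap, zero_add, ← Finset.sum_sub_distrib]
    refine Finset.sum_congr rfl fun a _ => ?_
    rw [sub_mul, map_sub, VectHom.map_even_mul A (c.σ_homog W hW _), ← AlgHom.commutes (c.σ W hW),
      VectHom.map_even_mul A (c.σ_homog W hW _), AlgHom.commutes, VectHom.map_algebraMap, zero_mul,
      sub_mul, sub_mul, c.sigma_mul_comm hW (h a), c.sigma_mul_comm hW (restrict hW _)]
    abel
  rw [key]
  refine Submodule.sum_mem _ fun a _ => Submodule.add_mem _ ?_ ?_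
  · exact c.sigma_mul_mem_vanishing hW (sub_self (p a)) _
  · exact c.sigma_mul_mem_vanishing hW (sub_eq_zero.2 (h2 a hpW)) _

theorem coeff_symm (f : F.fn c.dom) :
    f = (c.coeff f).sum fun μ g => c.ofSmooth g * F.mon (U := c.dom) c.y μ.1 := by
  refine ((Equiv.ofBijective _ (c.bijective c.target le_rfl)).apply_symm_apply f).symm.trans ?_
  change ((c.coeff f).sum fun μ g => c.ofSmooth g *
    F.mon (U := c.dom) (fun i => F.res le_rfl (c.y i)) μ.1) = _
  simp only [F.res_refl]

/-- A homogeneous vector field in coordinates. -/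
theorem map_eq_sum_pderiv {δ : ZMod 2 × ℤ} (A : F.VectHom δ) (f : F.fn c.dom) :
    A.1 c.dom f = ∑ a, A.1 c.dom (c.coord a) * c.pderiv a f := by
  have hμ : ∀ (μ : D.Mono) i, ((D.par i, (D.wt i : ℤ)) : ZMod 2 × ℤ).1 = 1 → μ.1 i ≤ 1 :=
    fun μ i => μ.2 i
  have h1 : ∀ a, A.1 c.dom (c.coord (Sum.inl a)) * c.pderiv (Sum.inl a) f =
      ∑ μ ∈ (c.coeff f).support, A.1 c.dom (c.coord (Sum.inl a)) *
        (c.ofSmooth ((c.coeff f μ).partialDeriv a) * F.mon (U := c.dom) c.y μ.1) :=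
    fun a => Finset.mul_sum _ _ _
  have h2 : ∀ i, A.1 c.dom (c.coord (Sum.inr i)) * c.pderiv (Sum.inr i) f =
      ∑ μ ∈ (c.coeff f).support, A.1 c.dom (c.y i) *
        ((sgn (D.par i * ∑ j with j < i, (μ.1 j : ZMod 2) * D.par j) * (μ.1 i : ℝ)) •
          (c.ofSmooth (c.coeff f μ) *
            F.mon (U := c.dom) c.y (Function.update μ.1 i (μ.1 i - 1)))) :=
    fun i => Finset.mul_sum _ _ _
  conv_lhs => rw [c.coeff_symm f, Finsupp.sum, map_sum]
  simp only [Fintype.sum_sum_type, h1, h2]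
  -- With the sums exchanged, both sides are compared monomial by monomial: differentiating `g(x)`
  -- gives the `x`-derivatives, differentiating `y^μ` the others.
  rw [Finset.sum_comm, Finset.sum_comm (s := (Finset.univ : Finset (Fin D.fibDim))),
    ← Finset.sum_add_distrib]
  refine Finset.sum_congr rfl fun μ _ => ?_
  refine (VectHom.map_even_mul A (c.σ_homog c.target le_rfl _) _).trans ?_
  refine congrArg₂ (· + ·) ((congrArg (· * _) (c.map_ofSmooth A _)).trans ?_) ?_
  · simp only [Finset.sum_mul, mul_assoc]
  · rw [VectHom.map_mon A c.y_homog (hμ μ), Finset.mul_sum]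
    refine Finset.sum_congr rfl fun i _ => ?_
    rw [mul_smul_comm, mul_smul_comm, ← mul_assoc, ← mul_assoc]
    congr 2
    exact c.sigma_mul_comm le_rfl _ _

/-- In a monomial of weight `0`, coordinates of positive weight have exponent `0`, and this exponent
is a factor of the derivative. -/
theorem pderiv_eq_zero {q : ZMod 2} {f : F.fn c.dom} (hf : f ∈ F.homog c.dom (q, 0))
    {a : D.Coord} (ha : D.coordWt a ≠ 0) : c.pderiv a f = 0 := by
  rcases a with a | i
  · exact (ha rfl).elim
  have hi : D.wt i ≠ 0 := ha
  obtain ⟨s, hs, hfs⟩ := c.exists_sum_term le_rfl hf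
  have hc : c.coeff f = s := by
    rw [hfs]
    exact (Equiv.ofBijective _ (c.bijective c.target le_rfl)).symm_apply_apply s
  simp only [pderiv, Sum.elim_inr, hc]
  refine Finset.sum_eq_zero fun μ hμ => ?_
  have h := μ.degree_snd
  rw [hs μ hμ] at h
  replace h : (0 : ℤ) = _ := h
  have h0 : ∑ i, μ.1 i * D.wt i = 0 := by exact_mod_cast h.symm
  have := (Finset.sum_eq_zero_iff.1 h0) i (Finset.mem_univ i)
  simp [(Nat.mul_eq_zero.1 this).resolve_right hi]

/-- Functions of weight `1` are linear in the coordinates of weight `1`. -/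
theorem exists_eq_sum_coord_mul {p : ZMod 2} {f : F.fn c.dom} (hf : f ∈ F.homog c.dom (p, 1)) :
    ∃ H : D.Coord → F.fn c.dom,
      (∀ i, D.coordWt i = 1 → H i ∈ F.homog c.dom (D.coordPar i + p, 0)) ∧
      f = ∑ i with D.coordWt i = 1, c.coord i * H i := by
  classical
  obtain ⟨s, hs, rfl⟩ := c.exists_sum_term le_rfl hf
  refine Finset.sum_induction _ (fun f => ∃ H : D.Coord → F.fn c.dom,
      (∀ i, D.coordWt i = 1 → H i ∈ F.homog c.dom (D.coordPar i + p, 0)) ∧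
      f = ∑ i with D.coordWt i = 1, c.coord i * H i) ?_ ?_ ?_
  · rintro f g ⟨H, hH, rfl⟩ ⟨K, hK, rfl⟩
    exact ⟨H + K, fun i hi => Submodule.add_mem _ (hH i hi) (hK i hi), by
      simp [mul_add, Finset.sum_add_distrib]⟩
  · exact ⟨0, fun i _ => Submodule.zero_mem _, by simp⟩
  · intro μ hμ
    have h := μ.degree_snd
    rw [hs μ hμ] at h
    replace h : (1 : ℤ) = _ := h
    obtain ⟨i, hi, d, k, hk, hd, he⟩ := mon_eq_mul_of_weight_one c.y_homog (μ := μ.1)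
      (by exact_mod_cast h.symm)
    have hd' : d = (D.par i + p, 0) := by
      have h3 : (D.par i, (D.wt i : ℤ)) + d = (p, 1) := hd.trans (hs μ hμ)
      have h4 : D.par i + d.1 = p := congrArg Prod.fst h3
      have h5 : (D.wt i : ℤ) + d.2 = 1 := congrArg Prod.snd h3
      refine Prod.ext ?_ ?_
      · rw [← h4, ← add_assoc, CharTwo.add_self_eq_zero, zero_add]
      · rw [hi] at h5
        simpa using h5
    have hk' : c.ofSmooth (s μ) * k ∈ F.homog c.dom (D.par i + p, 0) := by
      have := SetLike.mul_mem_graded (c.σ_homog c.target le_rfl (s μ)) hk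
      rwa [show ((0, 0) : ZMod 2 × ℤ) = 0 from rfl, zero_add, hd'] at this
    refine ⟨Pi.single (Sum.inr i) (c.ofSmooth (s μ) * k), fun j hj => ?_, ?_⟩
    · by_cases hji : j = Sum.inr i
      · subst hji
        rw [Pi.single_eq_same]
        exact hk'
      · rw [Pi.single_eq_of_ne hji]
        exact Submodule.zero_mem _
    · rw [Finset.sum_eq_single (Sum.inr i), Pi.single_eq_same]
      · simp only [term, F.res_refl]
        refine (congrArg (c.ofSmooth (s μ) * ·) he).trans ?_
        change c.ofSmooth (s μ) * (c.y i * k) = c.y i * (c.ofSmooth (s μ) * k)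
        rw [← mul_assoc, ← mul_assoc]
        congr 1
        exact c.sigma_mul_comm le_rfl _ _
      · intro j _ hji
        rw [Pi.single_eq_of_ne hji, mul_zero]
      · intro h
        exact (h (Finset.mem_filter.2 ⟨Finset.mem_univ _, hi⟩)).elim

theorem coord_mem (a : D.Coord) :
    c.coord a ∈ F.homog c.dom (D.coordPar a, (D.coordWt a : ℤ)) := by
  rcases a with a | i
  · exact c.σ_homog _ _ _
  · exact c.y_homog i

end Chart

end GradedSheaf

/-! ### The field `Q` in coordinates. -/

namespace GradedManifold

open GradedSheaf

variable {X : Type u} [TopologicalSpace X] [T2Space X] [SecondCountableTopology X]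
  {D : GradedDim} {F : GradedManifold.{u, v} X D} {Q : F.Vect}

/-- This makes the coordinate formula for homogeneous vector fields applicable to `Q`. -/
theorem homological_eq_single (hQ : F.IsHomological Q) : ∃ A : F.VectHom (1, 1),
    Q = F.single (1, 1) A := by
  refine ⟨Q (1, 1), DFinsupp.ext fun d => ?_⟩
  by_cases hd : d = (1, 1)
  · subst hd
    exact (DirectSum.lof_apply (M := fun d => F.VectHom d) ℝ _ _).symm
  · exact (homological_degree hQ d fun h => hd (Prod.ext h.1 h.2)).trans
      (single_mem_degreesIn (s := {(1, 1)}) rfl (Q (1, 1)) d hd).symm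

/-- A homological vector field in coordinates. -/
theorem exists_homological_coefficients (hQ : F.IsHomological Q) (c : F.Chart D) :
    ∃ Qc : D.Coord → D.Coord → F.fn c.dom,
      (∀ i a, D.coordWt i = 1 → D.coordWt a = 0 →
        Qc i a ∈ F.homog c.dom (D.coordPar i + D.coordPar a + 1, 0)) ∧
      (∀ a, D.coordWt a = 0 →
        F.act c.dom Q (c.coord a) = ∑ i with D.coordWt i = 1, c.coord i * Qc i a) ∧
      (∀ q : ZMod 2, ∀ f ∈ F.homog ⊤ (q, 0),
        F.res le_top (F.act ⊤ Q f) =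
          ∑ i with D.coordWt i = 1, ∑ a with D.coordWt a = 0,
            c.coord i * Qc i a * c.pderiv a (F.res le_top f)) := by
  have h : ∀ a, ∃ H : D.Coord → F.fn c.dom, D.coordWt a = 0 →
      (∀ i, D.coordWt i = 1 → H i ∈ F.homog c.dom (D.coordPar i + (1 + D.coordPar a), 0)) ∧
      F.act c.dom Q (c.coord a) = ∑ i with D.coordWt i = 1, c.coord i * H i := by
    intro a
    by_cases ha : D.coordWt a = 0
    · have hm := c.coord_mem a
      rw [ha] at hm
      obtain ⟨H, hH⟩ := c.exists_eq_sum_coord_mul (act_homological_mem hQ hm)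
      exact ⟨H, fun _ => hH⟩
    · exact ⟨0, fun h => (ha h).elim⟩
  choose Qc hQc using h
  refine ⟨fun i a => Qc a i, fun i a hi ha => ?_, fun a ha => (hQc a ha).2, fun q f hf => ?_⟩
  · rw [add_assoc, add_comm (D.coordPar a) 1]
    exact (hQc a ha).1 i hi
  · obtain ⟨A, hA⟩ := homological_eq_single hQ
    have hf' := F.res_homog (le_top : c.dom ≤ ⊤) _ f hf
    rw [act_res]
    have h1 : F.act c.dom Q (F.res le_top f) =
        ∑ a, F.act c.dom Q (c.coord a) * c.pderiv a (F.res le_top f) := by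
      simp only [hA, act_single]
      exact c.map_eq_sum_pderiv A _
    -- The chart formula sums over all coordinates; those of positive weight drop out by
    -- `pderiv_eq_zero`.
    rw [h1, Finset.sum_comm, Finset.sum_filter]
    refine Finset.sum_congr rfl fun a _ => ?_
    split_ifs with ha
    · rw [(hQc a ha).2, Finset.sum_mul]
    · rw [c.pderiv_eq_zero hf' ha, mul_zero]

end GradedManifold

theorem mainTheorem4 {X : Type u} [TopologicalSpace X] [T2Space X] [SecondCountableTopology X]
    {D : GradedDim} (F : GradedManifold.{u, v} X D)
    (Q : F.Vect) (hQ : F.IsHomological Q) :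
    -- for `u` in `Vect_{<0}(F)`, `a(u)` is a vector field on `M`, of parity `p + 1`
    (∀ p : ZMod 2, ∀ u ∈ F.neg ⊓ F.ofParity p, ∀ U : Opens X,
      (∀ q : ZMod 2, ∀ f ∈ F.homog U (q, 0), F.anchor Q u U f ∈ F.homog U (p + 1 + q, 0)) ∧
      (∀ q : ZMod 2, ∀ f ∈ F.homog U (q, 0), ∀ g : F.fn U,
        F.anchor Q u U (f * g) =
          F.anchor Q u U f * g + sgn ((p + 1) * q) • (f * F.anchor Q u U g))) ∧
    -- the Leibniz rule in the second argument
    (∀ p q : ZMod 2, ∀ u ∈ F.neg ⊓ F.ofParity p, ∀ f ∈ F.homog ⊤ (q, 0), ∀ v ∈ F.neg,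
      F.newBracket Q u (F.smul f v) =
        F.smul (F.anchor Q u ⊤ f) v + sgn ((p + 1) * q) • F.smul f (F.newBracket Q u v)) ∧
    -- the corrected rule in the first argument
    (∀ p q r : ZMod 2, ∀ f ∈ F.homog ⊤ (q, 0), ∀ u ∈ F.neg ⊓ F.ofParity p,
      ∀ v ∈ F.neg ⊓ F.ofParity r,
      F.newBracket Q (F.smul f u) v =
        sgn q • F.smul f (F.newBracket Q u v) +
          sgn ((q + p) * r) • F.smul (F.anchor Q v ⊤ f) u +
          F.delta Q q f (F.bracket u v)) ∧
    -- `δf` is an operator on `Vect_{<0}(F)` of parity `q + 1` and weight `1`; it is `0` on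
    -- `Vect_{-1}(F)`, and the multiplication by `Q f` in the weights less than `-1`
    (∀ q : ZMod 2, ∀ f ∈ F.homog ⊤ (q, 0),
      (∀ w ∈ F.neg, F.delta Q q f w ∈ F.neg) ∧
      (∀ r : ZMod 2, ∀ w ∈ F.neg ⊓ F.ofParity r, F.delta Q q f w ∈ F.ofParity (q + 1 + r)) ∧
      (∀ n : ℤ, n < 0 → ∀ w ∈ F.ofWeight n, F.delta Q q f w ∈ F.ofWeight (n + 1)) ∧
      (∀ w ∈ F.ofWeight (-1), F.delta Q q f w = 0) ∧
      (∀ w ∈ F.below (-1), F.delta Q q f w = F.smul (F.act ⊤ Q f) w) ∧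
      (∀ u ∈ F.neg, ∀ v ∈ F.neg,
        F.delta Q q f (F.bracket u v) = F.smul (F.act ⊤ Q f) (F.bracket u v))) ∧
    -- in coordinates, `Q f = ∑ y^i Q_i^a(x) ∂f/∂x^a`, where `∑ y^i Q_i^a(x)` is the coefficient
    -- of `∂/∂x^a` in `Q`; the sums are over the `y^i` of weight `1` and the `x^a` of weight `0`
    (∀ c : F.Chart D, ∃ Qc : D.Coord → D.Coord → F.fn c.dom,
      (∀ i a, D.coordWt i = 1 → D.coordWt a = 0 →
        Qc i a ∈ F.homog c.dom (D.coordPar i + D.coordPar a + 1, 0)) ∧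
      (∀ a, D.coordWt a = 0 →
        F.act c.dom Q (c.coord a) = ∑ i with D.coordWt i = 1, c.coord i * Qc i a) ∧
      (∀ q : ZMod 2, ∀ f ∈ F.homog ⊤ (q, 0),
        F.res le_top (F.act ⊤ Q f) =
          ∑ i with D.coordWt i = 1, ∑ a with D.coordWt a = 0,
            c.coord i * Qc i a * c.pderiv a (F.res le_top f))) :=
  ⟨fun _ _ hu _ => ⟨fun _ _ hf => GradedManifold.anchor_mem hQ hu hf,
      fun _ _ hf g => GradedManifold.anchor_mul hQ hu.2 hf g⟩,
    fun _ _ _ hu _ hf _ hv => GradedManifold.newBracket_smul_right hQ hu hf hv,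
    fun _ _ _ _ hf _ hu _ hv => GradedManifold.newBracket_smul_left hQ hf hu hv,
    fun _ _ hf => ⟨fun w _ => GradedManifold.delta_neg hf w,
      fun _ _ hw => GradedManifold.delta_ofParity hQ hf hw.2,
      fun _ _ _ hw => GradedManifold.delta_ofWeight hQ hf hw,
      fun _ hw => GradedManifold.delta_weight_neg_one hQ hf hw,
      fun _ hw => GradedManifold.delta_below hQ hf hw,
      fun _ hu _ hv => GradedManifold.delta_below hQ hf
        (GradedManifold.bracket_below (by simp) hu hv)⟩,
    fun c => GradedManifold.exists_homological_coefficients hQ c⟩
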